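/- Setting. Let $n\ge 1$ and let $A,B$ be two (measurable) sets ("phases") of $n$-qubit states. For $r,d_p\in\mathbb N$ suppose that there is a real function $f$ of the reduced density matrices $\rho_S=\mathrm{tr}_{\neg S}(\rho)$, $|S|\le r$, with $f(\rho)>1$ for $\rho\in A$ and $f(\rho)<-1$ for $\rho\in B$, and operators $O_{S_1,\dots,S_d}$ such that $$f^{(d_p)}(\rho)=\sum_{d=0}^{d_p}\frac1{d!}\sum_{S_1,\dots,S_d\subset[n],\,|S_i|\le r}\mathrm{tr}\big(O_{S_1,\dots,S_d}\,\rho_{S_1}\otimes\cdots\otimes\rho_{S_d}\big)$$ satisfies $|f(\rho)-f^{(d_p)}(\rho)|\le 1/4$ for all $n$-qubit states $\rho$. Let $C$ be (an upper bound on) the normalization constant $\sum_{d=0}^{d_p}\frac1{d!}\sum_{S_1,\dots,S_d}\|O_{S_1,\dots,S_d}\|_\infty$. The classical shadow $S_T(\rho)$ of size $T\ge 1$ is the record of $T$ independent rounds, each on a fresh copy of $\rho$, in which every qubit is measured in a uniformly random Pauli basis; $|s_i^{(t)}\rangle$ is the post-measurement state of qubit $i$ in round $t$ and $\sigma_i^{(t)}=3|s_i^{(t)}\rangle\langle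 s_i^{(t)}|-\mathbb I$. The shadow kernel is $$k(S,\tilde S)=\exp\Big(\frac1{T^2}\sum_{t,t'=1}^T\exp\Big(\frac1n\sum_{i=1}^n\mathrm{tr}\big(\sigma_i^{(t)}\tilde\sigma_i^{(t')}\big)\Big)\Big).$$ Draw $\rho$ from a probability distribution on states that belong to $A$ or $B$, put $y(\rho)=+1$ on $A$ and $-1$ on $B$, and let $\mathcal D$ be the joint law of $(S_T(\rho),y(\rho))$. Given i.i.d. training data $(S_\ell,y_\ell)_{\ell\le N}\sim\mathcal D$ with kernel matrix $K_{\ell\ell'}=k(S_\ell,S_{\ell'})$, the training problem is to minimize $\mathrm E_{\mathrm{tr}}(\alpha)=\sum_{\ell}\max\{0,1-y_\ell(K\alpha)_\ell\}$ over $\alpha\in\mathbb R^N$ with $\alpha^TK\alpha\le\Lambda^2$, where $\Lambda^2=4(2rn)^{rd_p}d_p^{d_p}C^2$ (with $0^0=1$). Theorem. Let $\delta,\epsilon\in(0,1)$ and $$T\ge\tfrac{512}{3}\,d_p^2C^2\,12^r\big(r(\log n+\log 12)+\log(N/\delta)\big),\qquad N\ge 256\,(2rn)^{rd_p}d_p^{d_p}C^2\,e^{e^5}\log(4/\delta)/\epsilon^2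 .$$ Then the training problem always has a solution, and: (i) with probability at least $1-\delta/2$ over the training data, every solution $\alpha_\sharp$ has zero training error, $\mathrm E_{\mathrm{tr}}(\alpha_\sharp)=0$; (ii) conditioned on the event in (i), with probability at least $1-\delta/2$ every solution $\alpha_\sharp$ yields a classifier $y_\sharp(S)=\mathrm{sign}\big(\sum_\ell[\alpha_\sharp]_\ell\,k(S_\ell,S)\big)$ with $\Pr_{(S,y)\sim\mathcal D}[y_\sharp(S)\ne y]\le\epsilon$ (where sign $0$ counts as an error); (iii) with probability at least $1-\delta$, both hold: zero training error and prediction error at most $\epsilon$. Moreover, for fixed $r,d_p,C,\delta,\epsilon$ there is a constant $\kappa$ such that for every $n\ge1$ the two requirements are met by some $N\le\kappa\,n^{rd_p}$ and $T\le\kappa(1+\log n)$; in particular $N$ and $T$ can be chosen polynomial in $n$. -/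

import Mathlib

noncomputable section

namespace ShadowSVM

open MeasureTheory
open scoped ComplexOrder

/-! ### Quantum states, tensor products, reduced density matrices -/

/-- Matrices acting on a register of qubits labelled by `ι`, in the computational basis. -/
abbrev QMatrix (ι : Type) : Type := Matrix (ι → Fin 2) (ι → Fin 2) ℂ

/-- `n`-qubit states: positive semidefinite matrices of unit trace. -/
abbrev State (n : ℕ) : Type :=
  {ρ : QMatrix (Fin n) // ρ.PosSemidef ∧ ρ.trace = 1}

/-- The σ-algebra generated by the matrix entries (the Borel σ-algebra). -/
instance (n : ℕ) : MeasurableSpace (State n) :=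
  MeasurableSpace.comap (fun (ρ : State n) (a b : Fin n → Fin 2) => ρ.1 a b) MeasurableSpace.pi

/-- The tensor product of a finite family of square matrices. -/
def tensor {ι : Type} [Fintype ι] {κ : ι → Type} (M : (i : ι) → Matrix (κ i) (κ i) ℂ) :
    Matrix ((i : ι) → κ i) ((i : ι) → κ i) ℂ :=
  fun a b => ∏ i, M i (a i) (b i)

/-- The partial trace over all qubits outside `A`: the reduced density matrix on `A`. -/
def reduced {n : ℕ} (ρ : QMatrix (Fin n)) (A : Finset (Fin n)) : QMatrix {i // i ∈ A} :=
  fun a b => ∑ c : {i // i ∉ A} → Fin 2,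
    ρ ((Equiv.piEquivPiSubtypeProd (fun i => i ∈ A) (fun _ => Fin 2)).symm (a, c))
      ((Equiv.piEquivPiSubtypeProd (fun i => i ∈ A) (fun _ => Fin 2)).symm (b, c))

/-- The operator (spectral) norm of a matrix. -/
def opNorm {κ : Type} [Fintype κ] [DecidableEq κ] (M : Matrix κ κ ℂ) : ℝ :=
  ‖Matrix.toEuclideanCLM (n := κ) (𝕜 := ℂ) M‖

/-! ### Truncated power series in reduced density matrices -/

/-- Subsystems of at most `r` qubits. -/
abbrev Subsystem (n r : ℕ) : Type := {A : Finset (Fin n) // A.card ≤ r}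

/-- Collections of matrices indexed by the subsystems of at most `r` qubits. -/
abbrev ReducedFamily (n r : ℕ) : Type := (A : Subsystem n r) → QMatrix {i // i ∈ A.1}

/-- All reduced density matrices of `ρ` on at most `r` qubits. -/
def reducedFamily {n : ℕ} (r : ℕ) (ρ : State n) : ReducedFamily n r :=
  fun A => reduced ρ.1 A.1

/-- Coefficients of a power series in reduced density matrices: for every degree `d` and all
subsystems `A₁, …, A_d` of at most `r` qubits, an operator `O_{A₁,…,A_d}` on the tensor product
of the Hilbert spaces of these `d` subsystems. -/
abbrev Coefficients (n r : ℕ) : Type :=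
  (d : ℕ) → (A : Fin d → Subsystem n r) →
    Matrix ((j : Fin d) → ({i // i ∈ (A j).1} → Fin 2))
      ((j : Fin d) → ({i // i ∈ (A j).1} → Fin 2)) ℂ

/-- `∑_{d ≤ d_p} (1/d!) ∑_{A₁,…,A_d} tr (O_{A₁,…,A_d} ρ_{A₁} ⊗ ⋯ ⊗ ρ_{A_d})`. -/
def powerSeries {n r : ℕ} (dp : ℕ) (O : Coefficients n r) (ρ : State n) : ℂ :=
  ∑ d ∈ Finset.range (dp + 1), (1 / (d.factorial : ℂ)) *
    ∑ A : Fin d → Subsystem n r,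
      (O d A * tensor (fun j => reduced ρ.1 (A j).1)).trace

/-- `∑_{d ≤ d_p} (1/d!) ∑_{A₁,…,A_d} ‖O_{A₁,…,A_d}‖_∞`. -/
def normalization {n r : ℕ} (dp : ℕ) (O : Coefficients n r) : ℝ :=
  ∑ d ∈ Finset.range (dp + 1), (1 / (d.factorial : ℝ)) *
    ∑ A : Fin d → Subsystem n r, opNorm (O d A)

/-! ### Classical shadows -/

/-- The Pauli matrices `X`, `Y`, `Z`. -/
def pauli : Fin 3 → Matrix (Fin 2) (Fin 2) ℂ :=
  ![!![0, 1; 1, 0], !![0, -Complex.I; Complex.I, 0], !![1, 0; 0, -1]]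

/-- The two outcomes `±1` of a measurement, and the two labels `±1`. -/
def pm (b : Bool) : ℝ := if b then 1 else -1

/-- One of the six single-qubit post-measurement states: a Pauli basis and an outcome. -/
abbrev Outcome : Type := Fin 3 × Bool

/-- The projector `|s⟩⟨s| = (I + o W) / 2` onto the post-measurement state. -/
def proj (s : Outcome) : Matrix (Fin 2) (Fin 2) ℂ :=
  (1 / 2 : ℂ) • (1 + (pm s.2 : ℂ) • pauli s.1)

/-- The single-qubit shadow factor `3 |s⟩⟨s| - I`. -/
def factor (s : Outcome) : Matrix (Fin 2) (Fin 2) ℂ := (3 : ℂ) • proj s - 1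

/-- The result of one round of randomized single-qubit Pauli measurements on `n` qubits. -/
abbrev Snapshot (n : ℕ) : Type := Fin n → Outcome

/-- Raw data `S_T(ρ)` of a classical shadow of size `T`. -/
abbrev Shadow (n T : ℕ) : Type := Fin T → Snapshot n

/-- Born's rule with uniformly random Pauli bases:
the probability `3⁻ⁿ tr (|s₁⟩⟨s₁| ⊗ ⋯ ⊗ |sₙ⟩⟨sₙ| ρ)` of the snapshot `s`. -/
def bornProb {n : ℕ} (ρ : State n) (s : Snapshot n) : ℝ :=
  (1 / 3 : ℝ) ^ n * ((tensor (fun i => proj (s i)) * ρ.1).trace).re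

/-- The law of one snapshot of `ρ`. -/
def snapshotLaw {n : ℕ} (ρ : State n) : Measure (Snapshot n) :=
  ∑ s : Snapshot n, ENNReal.ofReal (bornProb ρ s) • Measure.dirac s

/-- The law of `S_T(ρ)`: independent snapshots of `T` copies of `ρ`. -/
def shadowLaw {n : ℕ} (T : ℕ) (ρ : State n) : Measure (Shadow n T) :=
  Measure.pi (fun _ : Fin T => snapshotLaw ρ)

/-- The shadow kernel with hyperparameters `τ`, `γ`. -/
def shadowKernel {n T : ℕ} (τ γ : ℝ) (S S' : Shadow n T) : ℝ :=
  Real.exp (τ / (T : ℝ) ^ 2 * ∑ t : Fin T, ∑ t' : Fin T,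
    Real.exp (γ / (n : ℝ) *
      ∑ i : Fin n, ((factor (S t i) * factor (S' t' i)).trace).re))

/-! ### Labelled data -/

/-- A data point: a classical shadow and a label (`true` is `+1`, i.e. phase `A`;
`false` is `-1`, i.e. phase `B`). -/
abbrev DataPoint (n T : ℕ) : Type := Shadow n T × Bool

open Classical in
/-- The joint law of `(S_T(ρ), y(ρ))`, where `ρ` is drawn from a distribution `μ` on states that
belong to phase `A` or to phase `B`, and `y(ρ) = +1` exactly if `ρ` belongs to phase `A`. -/
def dataLaw {n : ℕ} (T : ℕ) (A : Set (State n)) (μ : Measure (State n)) :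
    Measure (DataPoint n T) :=
  μ.bind (fun ρ => (shadowLaw T ρ).map (fun S => (S, decide (ρ ∈ A))))

/-! ### Soft-margin support vector machine with the shadow kernel (`τ = γ = 1`) -/

/-- The function `S ↦ ∑_ℓ α_ℓ k(S_ℓ, S)` belonging to a coefficient vector `α`. -/
def decision {n T N : ℕ} (ω : Fin N → DataPoint n T) (α : Fin N → ℝ) (S : Shadow n T) : ℝ :=
  ∑ l, α l * shadowKernel 1 1 (ω l).1 S

/-- Training error `∑_ℓ max {0, 1 - y_ℓ (K α)_ℓ}`. -/
def trainingError {n T N : ℕ} (ω : Fin N → DataPoint n T) (α : Fin N → ℝ) : ℝ :=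
  ∑ l, max 0 (1 - pm (ω l).2 * decision ω α (ω l).1)

/-- The margin constraint `αᵀ K α ≤ Λ²`. -/
def Feasible {n T N : ℕ} (Λsq : ℝ) (ω : Fin N → DataPoint n T) (α : Fin N → ℝ) : Prop :=
  ∑ l, ∑ l', α l * α l' * shadowKernel 1 1 (ω l).1 (ω l').1 ≤ Λsq

/-- `α` solves the training problem: it minimizes the training error under the constraint. -/
def IsSolution {n T N : ℕ} (Λsq : ℝ) (ω : Fin N → DataPoint n T) (α : Fin N → ℝ) : Prop :=
  Feasible Λsq ω α ∧ ∀ β, Feasible Λsq ω β → trainingError ω α ≤ trainingError ω β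

/-- The probability that the classifier `S ↦ sign (∑_ℓ α_ℓ k(S_ℓ, S))` mislabels a fresh data
point. (A vanishing decision function has `Real.sign` equal to `0` and counts as an error, which is
the least favourable convention.) -/
def predictionError {n T N : ℕ} (D : Measure (DataPoint n T)) (ω : Fin N → DataPoint n T)
    (α : Fin N → ℝ) : ℝ :=
  D.real {x | Real.sign (decision ω α x.1) ≠ pm x.2}

/-- Training sets for which training succeeds perfectly: every solution of the training problem
has training error zero. -/
def PerfectTraining {n T N : ℕ} (Λsq : ℝ) : Set (Fin N → DataPoint n T) :=
  {ω | ∀ α, IsSolution Λsq ω α → trainingError ω α = 0}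

/-- Training sets for which every solution of the training problem has prediction error at
most `ε`. -/
def GoodPrediction {n T N : ℕ} (D : Measure (DataPoint n T)) (Λsq ε : ℝ) :
    Set (Fin N → DataPoint n T) :=
  {ω | ∀ α, IsSolution Λsq ω α → predictionError D ω α ≤ ε}

/-! ### The parameters -/

/-- The squared margin constant `Λ² = 4 (2rn)^{r d_p} d_p^{d_p} C²`. -/
def marginSq (n r dp : ℕ) (C : ℝ) : ℝ :=
  4 * (2 * r * n : ℝ) ^ (r * dp) * (dp : ℝ) ^ dp * C ^ 2

/-- The sufficient shadow size. -/
def requiredShadowSize (n r dp N : ℕ) (C δ : ℝ) : ℝ :=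
  512 / 3 * (dp : ℝ) ^ 2 * C ^ 2 * 12 ^ r *
    (r * (Real.log n + Real.log 12) + Real.log (N / δ))

/-- The sufficient number of training data. -/
def requiredTrainingSize (n r dp : ℕ) (C δ ε : ℝ) : ℝ :=
  256 * (2 * r * n : ℝ) ^ (r * dp) * (dp : ℝ) ^ dp * C ^ 2 * Real.exp (Real.exp 5) *
    Real.log (4 / δ) / ε ^ 2

end ShadowSVM

end

/-! ### Kernel interpolation and solvability of the training problem. -/

noncomputable section
namespace ShadowSVM
open Matrix

/-! The target classifier is `g S = 2 * (shadowSeries dp O S).re`, the truncated series evaluated at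
the shadow estimates of the reduced states. Three facts carry the theorem.

First, `g` lies in the reproducing kernel Hilbert space of the shadow kernel, with squared norm at
most `Λ²`. No such space is built: shadows form a finite set, and the property is expressed by the
inequality `(a · g)² ≤ Λ² (a · K a)` for all `a`. It follows by comparing kernels in the Loewner
order. By the Schur product theorem and the exponential series, an entrywise exponential of a
positive semidefinite kernel dominates each of its Taylor terms. The inner exponential factorizes
over qubits, so it dominates `n ^ (-|A|)` times the Gram kernel of the shadow factors on `A`. The
degree `d` term of the outer exponential then dominates a multiple of the Gram kernel of the tensor
products `σ_{A₁} ⊗ ⋯ ⊗ σ_{A_d}`. Cauchy-Schwarz for the Frobenius inner product finishes the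
estimate (`sq_sum_seriesAt_le`).

Second, `g` has margin one on a random data point, up to probability `δ / (2N)`. The Pauli
coefficients of a snapshot are unbiased, with range and second moment at most `3 ^ |A|`. A Bernstein
bound, a union bound and Parseval's identity give trace-norm accuracy of all estimates
(`measureReal_shadowState_inaccurate_le`). Multilinear expansion turns this into an error of at most
`1/4` in the series. With the approximation error `1/4`, the signed series is at least `1/2`, and
doubling gives margin one. A union bound over the data and interpolation by a kernel expansion
(`exists_interpolation`) then make zero training error attainable under the constraint, so every
solution attains it.

Third, zero training error implies good prediction, by the PAC-Bayes bound `pacBayes_margin` with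
Gaussian priors and posteriors on a finite-dimensional feature space. It holds simultaneously for
all classifiers of bounded norm, hence for every solution. Perfect training without good prediction
has probability at most `δ/4`; this leaves room for both the conditional and the joint statement. -/

/-- A positive semidefinite kernel on a finite set has a finite-dimensional feature map. -/
lemma exists_featureMap {X : Type} [Fintype X] [DecidableEq X] {K : Matrix X X ℝ}
    (hK : K.PosSemidef) :
    ∃ φ : X → EuclideanSpace ℝ X, ∀ x y, inner ℝ (φ x) (φ y) = K x y := by
  open scoped MatrixOrder in
  obtain ⟨B, hB⟩ := CStarAlgebra.nonneg_iff_eq_star_mul_self.mp hK.nonneg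
  refine ⟨fun x => WithLp.toLp 2 (fun z => B z x), fun x y => ?_⟩
  rw [hB]
  simp [Matrix.mul_apply, PiLp.inner_apply, mul_comm]

/-- Interpolation in a reproducing kernel Hilbert space: values dominated by the kernel are attained
by a kernel expansion of bounded norm. -/
lemma exists_interpolation {ι : Type} [Fintype ι] [DecidableEq ι] {K : Matrix ι ι ℝ}
    (hK : K.PosSemidef) {v : ι → ℝ} {c : ℝ}
    (hv : ∀ a : ι → ℝ, (a ⬝ᵥ v) ^ 2 ≤ c * (a ⬝ᵥ K *ᵥ a)) (hc : 0 ≤ c) :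
    ∃ α : ι → ℝ, K *ᵥ α = v ∧ α ⬝ᵥ K *ᵥ α ≤ c := by
  have hs : (K.toEuclideanLin).IsSymmetric := Matrix.isSymmetric_toEuclideanLin_iff.mpr hK.1
  -- The range of a symmetric operator is the orthogonal complement of its kernel, and the
  -- domination hypothesis forces `v` to be orthogonal to that kernel.
  have hmem : WithLp.toLp 2 v ∈ (LinearMap.range K.toEuclideanLin) := by
    rw [← Submodule.orthogonal_orthogonal (LinearMap.range K.toEuclideanLin), hs.orthogonal_range,
      Submodule.mem_orthogonal]
    intro u hu
    have hu' : K *ᵥ u.ofLp = 0 := by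
      have := congrArg WithLp.ofLp (LinearMap.mem_ker.mp hu)
      simpa using this
    have h := hv u.ofLp
    rw [hu'] at h
    have h0 : u.ofLp ⬝ᵥ v = 0 := by
      have : (u.ofLp ⬝ᵥ v) ^ 2 ≤ 0 := by simpa using h
      exact pow_eq_zero_iff (two_ne_zero) |>.mp (le_antisymm this (sq_nonneg _))
    simpa [PiLp.inner_apply, dotProduct, mul_comm] using h0
  obtain ⟨α, hα⟩ := hmem
  have hα' : K *ᵥ α.ofLp = v := by
    have := congrArg WithLp.ofLp hα
    simpa using this
  refine ⟨α.ofLp, hα', ?_⟩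
  -- At `a = α` the hypothesis reads `q² ≤ c q` for `q = α · Kα`, hence `q ≤ c`.
  have h := hv α.ofLp
  rw [hα'] at h ⊢
  by_contra! hlt
  nlinarith

/-- The minimization of a continuous function of a bounded vector in the span of a finite family. -/
lemma exists_min_span {ι E : Type} [Fintype ι] [NormedAddCommGroup E] [InnerProductSpace ℝ E]
    [FiniteDimensional ℝ E] (φ : ι → E) (F : E → ℝ) (hF : Continuous F) {c : ℝ} (hc : 0 ≤ c) :
    ∃ α : ι → ℝ, ‖∑ l, α l • φ l‖ ^ 2 ≤ c ∧
      ∀ β : ι → ℝ, ‖∑ l, β l • φ l‖ ^ 2 ≤ c → F (∑ l, α l • φ l) ≤ F (∑ l, β l • φ l) := by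
  have hcl : IsClosed ((Submodule.span ℝ (Set.range φ) : Submodule ℝ E) : Set E) :=
    Submodule.closed_of_finiteDimensional _
  have hcomp : IsCompact (Metric.closedBall (0 : E) (Real.sqrt c) ∩
      ((Submodule.span ℝ (Set.range φ) : Submodule ℝ E) : Set E)) :=
    (isCompact_closedBall _ _).inter_right hcl
  have hball : ∀ w : E, w ∈ Metric.closedBall (0 : E) (Real.sqrt c) ↔ ‖w‖ ^ 2 ≤ c := by
    intro w
    rw [mem_closedBall_zero_iff, Real.le_sqrt (norm_nonneg _) hc]
  have hspan : ∀ w : E, w ∈ (Submodule.span ℝ (Set.range φ) : Submodule ℝ E) ↔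
      ∃ α : ι → ℝ, ∑ l, α l • φ l = w := fun w => Submodule.mem_span_range_iff_exists_fun ℝ
  obtain ⟨w, ⟨hw1, hw2⟩, hmin⟩ := hcomp.exists_isMinOn
    ⟨0, by simp [Real.sqrt_nonneg], Submodule.zero_mem _⟩ hF.continuousOn
  obtain ⟨α, rfl⟩ := (hspan w).mp hw2
  refine ⟨α, (hball _).mp hw1, fun β hβ => hmin ⟨(hball _).mpr hβ, (hspan _).mpr ⟨β, rfl⟩⟩⟩

lemma decision_eq_inner {n T N : ℕ} {E : Type} [NormedAddCommGroup E] [InnerProductSpace ℝ E]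
    {φ : Shadow n T → E} (hφ : ∀ S S', inner ℝ (φ S) (φ S') = shadowKernel 1 1 S S')
    (ω : Fin N → DataPoint n T) (α : Fin N → ℝ) (S : Shadow n T) :
    decision ω α S = inner ℝ (∑ l, α l • φ (ω l).1) (φ S) := by
  simp [decision, sum_inner, real_inner_smul_left, hφ]

lemma feasible_iff_norm {n T N : ℕ} {E : Type} [NormedAddCommGroup E] [InnerProductSpace ℝ E]
    {φ : Shadow n T → E} (hφ : ∀ S S', inner ℝ (φ S) (φ S') = shadowKernel 1 1 S S')
    (Λsq : ℝ) (ω : Fin N → DataPoint n T) (α : Fin N → ℝ) :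
    Feasible Λsq ω α ↔ ‖∑ l, α l • φ (ω l).1‖ ^ 2 ≤ Λsq := by
  rw [← real_inner_self_eq_norm_sq]
  simp only [Feasible, sum_inner, inner_sum, real_inner_smul_left, real_inner_smul_right, hφ]
  rw [Finset.sum_comm]
  refine iff_of_eq (congrArg (· ≤ Λsq) (Finset.sum_congr rfl fun l _ =>
    Finset.sum_congr rfl fun l' _ => by ring))

/-- Objective and constraint depend on `α` only through the vector it represents in feature space.
There the feasible set is compact, while the set of feasible coefficient vectors need not be bounded
when the kernel matrix is singular. -/
lemma exists_isSolution {n T N : ℕ} {E : Type} [NormedAddCommGroup E] [InnerProductSpace ℝ E]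
    [FiniteDimensional ℝ E]
    {φ : Shadow n T → E} (hφ : ∀ S S', inner ℝ (φ S) (φ S') = shadowKernel 1 1 S S')
    {Λsq : ℝ} (hΛ : 0 ≤ Λsq) (ω : Fin N → DataPoint n T) :
    ∃ α, IsSolution Λsq ω α := by
  have key : ∀ α, trainingError ω α =
      (fun w : E => ∑ l, max 0 (1 - pm (ω l).2 * inner ℝ w (φ (ω l).1)))
        (∑ l, α l • φ (ω l).1) := by
    intro α
    simp only [trainingError, decision_eq_inner hφ]
  obtain ⟨α, h1, h2⟩ := exists_min_span (fun l => φ (ω l).1)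
    (fun w : E => ∑ l, max 0 (1 - pm (ω l).2 * inner ℝ w (φ (ω l).1))) (by fun_prop) hΛ
  refine ⟨α, (feasible_iff_norm hφ _ _ _).mpr h1, fun β hβ => ?_⟩
  rw [key, key]
  exact h2 β ((feasible_iff_norm hφ _ _ _).mp hβ)

lemma trainingError_nonneg {n T N : ℕ} (ω : Fin N → DataPoint n T) (α : Fin N → ℝ) :
    0 ≤ trainingError ω α :=
  Finset.sum_nonneg fun _ _ => le_max_left _ _

lemma one_le_margin_of_trainingError_eq_zero {n T N : ℕ} {ω : Fin N → DataPoint n T}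
    {α : Fin N → ℝ} (h : trainingError ω α = 0) (l : Fin N) :
    1 ≤ pm (ω l).2 * decision ω α (ω l).1 := by
  have h1 := (Finset.sum_eq_zero_iff_of_nonneg (fun _ _ => le_max_left _ _)).mp h l
    (Finset.mem_univ l)
  linarith [le_max_right 0 (1 - pm (ω l).2 * decision ω α (ω l).1)]

/-- If a function of bounded norm in the reproducing kernel Hilbert space has margin one on the
training data, then training succeeds perfectly. -/
lemma mem_perfectTraining {n T N : ℕ}
    (hK : (Matrix.of (shadowKernel (n := n) (T := T) 1 1)).PosSemidef)
    {Λsq : ℝ} (hΛ : 0 ≤ Λsq) (g : Shadow n T → ℝ)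
    (hg : ∀ a : Shadow n T → ℝ, (a ⬝ᵥ g) ^ 2 ≤
      Λsq * (a ⬝ᵥ (Matrix.of (shadowKernel (n := n) (T := T) 1 1)) *ᵥ a))
    {ω : Fin N → DataPoint n T} (hω : ∀ l, 1 ≤ pm (ω l).2 * g (ω l).1) :
    ω ∈ PerfectTraining Λsq := by
  set K := Matrix.of (shadowKernel (n := n) (T := T) 1 1) with hKdef
  let s : Fin N → Shadow n T := fun l => (ω l).1
  -- Coefficients on the sample are pushed forward to coefficients on all shadows; repeated shadows
  -- have their coefficients added, so no injectivity is needed.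
  have hv : ∀ a : Fin N → ℝ, (a ⬝ᵥ (g ∘ s)) ^ 2 ≤ Λsq * (a ⬝ᵥ (K.submatrix s s) *ᵥ a) := by
    intro a
    classical
    have h1 : ∀ h : Shadow n T → ℝ,
        (fun S => ∑ l, if s l = S then a l else 0) ⬝ᵥ h = a ⬝ᵥ (h ∘ s) := by
      intro h
      simp only [dotProduct, Finset.sum_mul]
      rw [Finset.sum_comm]
      simp [ite_mul]
    have h2 : (K *ᵥ (fun S => ∑ l, if s l = S then a l else 0)) ∘ s = (K.submatrix s s) *ᵥ a := by
      funext l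
      simp only [Function.comp, mulVec]
      rw [dotProduct_comm, h1, dotProduct_comm]
      rfl
    have := hg (fun S => ∑ l, if s l = S then a l else 0)
    rwa [h1, h1, h2] at this
  obtain ⟨β, hβ, hβ2⟩ := exists_interpolation (hK.submatrix s) hv hΛ
  have hdec : ∀ l, decision ω β (ω l).1 = g (ω l).1 := by
    intro l
    have := congrFun hβ l
    simp only [mulVec, dotProduct, submatrix_apply, Function.comp] at this
    rw [← this, decision]
    refine Finset.sum_congr rfl fun l' _ => ?_
    have hsymm := hK.1.apply (s l) (s l')
    simp only [star_trivial, hKdef, of_apply] at hsymm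
    simp only [hKdef, of_apply]
    rw [mul_comm, hsymm]
  have hfeas : Feasible Λsq ω β := by
    refine le_trans (le_of_eq ?_) hβ2
    simp only [dotProduct, mulVec, Finset.mul_sum, submatrix_apply, hKdef, of_apply]
    refine Finset.sum_congr rfl fun l _ => Finset.sum_congr rfl fun l' _ => ?_
    ring
  have herr : trainingError ω β = 0 := by
    refine Finset.sum_eq_zero fun l _ => ?_
    rw [hdec, max_eq_left]
    linarith [hω l]
  intro α hα
  exact le_antisymm (herr ▸ hα.2 β hfeas) (trainingError_nonneg ω α)

end ShadowSVM
end

/-! ### Gaussian measures and Gaussian linear classifiers. -/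

noncomputable section
namespace ShadowSVM
open MeasureTheory

/-- The indicator of a misclassification of `v` by the linear functional `g`. -/
def linLoss {E : Type} [NormedAddCommGroup E] [InnerProductSpace ℝ E]
    (g v : E) : ℝ := by
  classical exact if inner ℝ g v ≤ 0 then 1 else 0

lemma linLoss_nonneg {E : Type} [NormedAddCommGroup E] [InnerProductSpace ℝ E]
    (g v : E) : 0 ≤ linLoss g v := by
  unfold linLoss; split_ifs <;> norm_num

lemma linLoss_le_one {E : Type} [NormedAddCommGroup E] [InnerProductSpace ℝ E]
    (g v : E) : linLoss g v ≤ 1 := by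
  unfold linLoss; split_ifs <;> norm_num

section Gaussian

variable (E : Type) [NormedAddCommGroup E] [InnerProductSpace ℝ E] [FiniteDimensional ℝ E]
  [MeasurableSpace E] [BorelSpace E]

/-- The density of the standard Gaussian measure of a Euclidean space. -/
def gaussianDensity (g : E) : ℝ :=
  (∫ v : E, Real.exp (-(1 / 2 : ℝ) * ‖v‖ ^ 2))⁻¹ * Real.exp (-(1 / 2 : ℝ) * ‖g‖ ^ 2)

/-- The standard Gaussian measure of a Euclidean space. -/
def gaussianMeasure : Measure E :=
  volume.withDensity (fun g => ((gaussianDensity E g).toNNReal : ENNReal))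

variable {E}

lemma gaussianDensity_nonneg (g : E) : 0 ≤ gaussianDensity E g :=
  mul_nonneg (inv_nonneg.mpr (integral_nonneg fun _ => (Real.exp_pos _).le)) (Real.exp_pos _).le

lemma continuous_gaussianDensity : Continuous (gaussianDensity E) := by
  unfold gaussianDensity
  fun_prop

lemma integral_gaussianMeasure (F : E → ℝ) :
    ∫ g, F g ∂(gaussianMeasure E) = ∫ g, gaussianDensity E g * F g := by
  rw [gaussianMeasure, integral_withDensity_eq_integral_smul
    (continuous_gaussianDensity.measurable.real_toNNReal)]
  refine integral_congr_ae (Filter.Eventually.of_forall fun g => ?_)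
  simp only [NNReal.smul_def, Real.coe_toNNReal _ (gaussianDensity_nonneg g), smul_eq_mul]

lemma integral_gaussianDensity : ∫ g, gaussianDensity E g = 1 := by
  have hpos : 0 < ∫ v : E, Real.exp (-(1 / 2 : ℝ) * ‖v‖ ^ 2) := by
    rw [GaussianFourier.integral_rexp_neg_mul_sq_norm (by norm_num)]
    positivity
  unfold gaussianDensity
  rw [integral_const_mul, inv_mul_cancel₀ hpos.ne']

instance isProbabilityMeasure_gaussianMeasure : IsProbabilityMeasure (gaussianMeasure E) := by
  -- A non-integrable function has integral zero by convention, whereas this integral is one.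
  have hint : Integrable (gaussianDensity E) := by
    by_contra h
    have := integral_gaussianDensity (E := E)
    rw [integral_undef h] at this
    exact zero_ne_one this
  constructor
  rw [gaussianMeasure, withDensity_apply _ MeasurableSet.univ, Measure.restrict_univ]
  have := ofReal_integral_eq_lintegral_ofReal hint
    (Filter.Eventually.of_forall gaussianDensity_nonneg)
  rw [integral_gaussianDensity] at this
  simpa [ENNReal.ofReal] using this.symm

/-- The Cameron-Martin formula. -/
lemma integral_gaussianMeasure_shift (F : E → ℝ) (m : E) :
    ∫ g, F (g + m) ∂(gaussianMeasure E) =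
      ∫ g, F g * Real.exp (inner ℝ m g - ‖m‖ ^ 2 / 2) ∂(gaussianMeasure E) := by
  rw [integral_gaussianMeasure, integral_gaussianMeasure,
    ← integral_add_right_eq_self (fun g => gaussianDensity E g * (F g * _)) m]
  refine integral_congr_ae (Filter.Eventually.of_forall fun g => ?_)
  simp only [gaussianDensity]
  have : Real.exp (-(1 / 2 : ℝ) * ‖g‖ ^ 2) = Real.exp (-(1 / 2 : ℝ) * ‖g + m‖ ^ 2) *
      Real.exp (inner ℝ m (g + m) - ‖m‖ ^ 2 / 2) := by
    rw [← Real.exp_add, norm_add_sq_real, inner_add_right, real_inner_self_eq_norm_sq,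
      real_inner_comm]
    congr 1
    ring
  rw [this]
  ring

lemma integral_gaussianMeasure_neg (F : E → ℝ) :
    ∫ g, F (-g) ∂(gaussianMeasure E) = ∫ g, F g ∂(gaussianMeasure E) := by
  rw [integral_gaussianMeasure, integral_gaussianMeasure,
    ← integral_neg_eq_self (fun g => gaussianDensity E g * F g)]
  simp [gaussianDensity]

/-- This is the Cameron-Martin formula for the constant function one. -/
lemma integral_exp_inner_gaussianMeasure (u : E) :
    ∫ g, Real.exp (inner ℝ u g) ∂(gaussianMeasure E) = Real.exp (‖u‖ ^ 2 / 2) := by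
  have h := integral_gaussianMeasure_shift (fun _ : E => (1 : ℝ)) u
  simp only [integral_const, probReal_univ, smul_eq_mul, mul_one, one_mul, Real.exp_sub] at h
  rw [integral_div, eq_div_iff (Real.exp_pos _).ne', one_mul] at h
  exact h.symm

lemma integrable_exp_inner_gaussianMeasure (u : E) :
    Integrable (fun g => Real.exp (inner ℝ u g)) (gaussianMeasure E) := by
  by_contra h
  have := integral_exp_inner_gaussianMeasure u
  rw [integral_undef h] at this
  exact (Real.exp_pos _).ne this

lemma integrable_inner_gaussianMeasure (u : E) :
    Integrable (fun g => inner ℝ u g) (gaussianMeasure E) := by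
  refine ((integrable_exp_inner_gaussianMeasure u).add
    (integrable_exp_inner_gaussianMeasure (-u))).mono' (by fun_prop)
    (Filter.Eventually.of_forall fun g => ?_)
  simp only [Pi.add_apply, inner_neg_left, Real.norm_eq_abs]
  have h1 := Real.add_one_le_exp (inner ℝ u g)
  have h2 := Real.add_one_le_exp (-inner ℝ u g)
  have h3 := Real.exp_pos (inner ℝ u g)
  have h4 := Real.exp_pos (-inner ℝ u g)
  rw [abs_le]
  constructor <;> linarith

lemma integral_inner_gaussianMeasure (u : E) :
    ∫ g, inner ℝ u g ∂(gaussianMeasure E) = 0 := by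
  have h := integral_gaussianMeasure_neg (fun g : E => inner ℝ u g)
  simp only [inner_neg_right, integral_neg] at h
  linarith

lemma measurable_linLoss (m v : E) : Measurable (fun g => linLoss (g + m) v) := by
  unfold linLoss
  refine Measurable.ite ?_ measurable_const measurable_const
  exact measurableSet_le (by fun_prop) measurable_const

lemma integrable_linLoss (m v : E) :
    Integrable (fun g => linLoss (g + m) v) (gaussianMeasure E) :=
  Integrable.of_bound (measurable_linLoss m v).aestronglyMeasurable 1
    (Filter.Eventually.of_forall fun g => by
      rw [Real.norm_eq_abs, abs_of_nonneg (linLoss_nonneg _ _)]; exact linLoss_le_one _ _)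

/-- A Gaussian classifier centred at a classifier that errs errs with probability at least
one half. -/
lemma half_le_integral_linLoss {m v : E} (h : inner ℝ m v ≤ 0) :
    1 / 2 ≤ ∫ g, linLoss (g + m) v ∂(gaussianMeasure E) := by
  have h1 := integral_gaussianMeasure_neg (fun g : E => linLoss (g + m) v)
  have hi := integrable_linLoss m v
  have hi' : Integrable (fun g => linLoss (-g + m) v) (gaussianMeasure E) := by
    refine Integrable.of_bound ((measurable_linLoss m v).comp measurable_neg).aestronglyMeasurable 1
      (Filter.Eventually.of_forall fun g => ?_)
    rw [Real.norm_eq_abs]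
    rw [abs_of_nonneg (linLoss_nonneg _ _)]; exact linLoss_le_one _ _
  -- The scores at `g + m` and `-g + m` add up to `2⟨m, v⟩ ≤ 0`, so at least one of the two
  -- classifiers errs.
  have h2 : ∫ _ : E, (1 : ℝ) ∂(gaussianMeasure E) ≤
      ∫ g, (linLoss (g + m) v + linLoss (-g + m) v) ∂(gaussianMeasure E) := by
    refine integral_mono (integrable_const _) (hi.add hi') fun g => ?_
    simp only [linLoss, inner_add_left, inner_neg_left]
    split_ifs <;> first | (exfalso; linarith) | norm_num
  rw [integral_add hi hi', h1] at h2
  simp at h2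
  linarith

/-- A Gaussian classifier centred at a classifier of large margin errs rarely. -/
lemma integral_linLoss_le {m v : E} {t Rsq : ℝ} (ht : 0 ≤ t) (hR : 0 < Rsq)
    (hv : ‖v‖ ^ 2 ≤ Rsq) (h : t ≤ inner ℝ m v) :
    ∫ g, linLoss (g + m) v ∂(gaussianMeasure E) ≤ Real.exp (-(t ^ 2 / (2 * Rsq))) := by
  -- The Chernoff parameter that minimizes `s² Rsq / 2 - s t`.
  set s : ℝ := t / Rsq with hs
  have hs0 : 0 ≤ s := by positivity
  have h1 : ∫ g, linLoss (g + m) v ∂(gaussianMeasure E) ≤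
      ∫ g, Real.exp (inner ℝ (-(s • v)) g) * Real.exp (-(s * t)) ∂(gaussianMeasure E) := by
    refine integral_mono (integrable_linLoss m v)
      ((integrable_exp_inner_gaussianMeasure _).mul_const _) fun g => ?_
    simp only [linLoss]
    split_ifs with hg
    · rw [← Real.exp_add]
      refine Real.one_le_exp ?_
      rw [inner_add_left] at hg
      rw [inner_neg_left, real_inner_smul_left, real_inner_comm]
      nlinarith
    · positivity
  rw [integral_mul_const, integral_exp_inner_gaussianMeasure, ← Real.exp_add] at h1
  refine h1.trans (Real.exp_le_exp.mpr ?_)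
  rw [norm_neg, norm_smul, mul_pow, Real.norm_eq_abs, sq_abs]
  have h2 : s ^ 2 * ‖v‖ ^ 2 ≤ s ^ 2 * Rsq := mul_le_mul_of_nonneg_left hv (sq_nonneg _)
  have h3 : s ^ 2 * Rsq / 2 - s * t = -(t ^ 2 / (2 * Rsq)) := by
    rw [hs]; field_simp; ring
  linarith

/-- Gibbs variational inequality for Gaussian shifts. -/
lemma exp_le_integral_exp_gaussianMeasure {H : E → ℝ} (hH : Measurable H) {c : ℝ}
    (hb : ∀ g, |H g| ≤ c) (m : E) :
    Real.exp (∫ g, H (g + m) ∂(gaussianMeasure E) - ‖m‖ ^ 2 / 2) ≤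
      ∫ g, Real.exp (H g) ∂(gaussianMeasure E) := by
  have hi1 : Integrable (fun g => H (g + m)) (gaussianMeasure E) :=
    Integrable.of_bound (hH.comp (measurable_add_const m)).aestronglyMeasurable c
      (Filter.Eventually.of_forall fun g => hb _)
  have hi2 : Integrable (fun g => H (g + m) - inner ℝ m g) (gaussianMeasure E) :=
    hi1.sub (integrable_inner_gaussianMeasure m)
  have hi : Integrable (fun g => H (g + m) - inner ℝ m g - ‖m‖ ^ 2 / 2) (gaussianMeasure E) :=
    hi2.sub (integrable_const _)
  have e1 : ∫ g, (H (g + m) - inner ℝ m g - ‖m‖ ^ 2 / 2) ∂(gaussianMeasure E) =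
      ∫ g, H (g + m) ∂(gaussianMeasure E) - ‖m‖ ^ 2 / 2 := by
    rw [integral_sub hi2 (integrable_const _),
      integral_sub hi1 (integrable_inner_gaussianMeasure m), integral_inner_gaussianMeasure]
    simp
  have e2 : ∫ g, Real.exp (H (g + m) - inner ℝ m g - ‖m‖ ^ 2 / 2) ∂(gaussianMeasure E) =
      ∫ g, Real.exp (H g) ∂(gaussianMeasure E) := by
    -- The added terms cancel the Cameron-Martin density. Jensen's inequality for the exponential
    -- then gives the claim, with `‖m‖² / 2` as the relative entropy of the shifted Gaussian.
    have h := integral_gaussianMeasure_shift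
      (fun g => Real.exp (H g - inner ℝ m g + ‖m‖ ^ 2 / 2)) m
    simp only [← Real.exp_add] at h
    calc _ = _ := ?_
      _ = _ := h
      _ = _ := ?_
    · refine integral_congr_ae (Filter.Eventually.of_forall fun g => ?_)
      simp only [inner_add_right, real_inner_self_eq_norm_sq]
      congr 1; ring
    · refine integral_congr_ae (Filter.Eventually.of_forall fun g => ?_)
      simp only
      congr 1; ring
  have hexp : Integrable (fun g => Real.exp (H (g + m) - inner ℝ m g - ‖m‖ ^ 2 / 2))
      (gaussianMeasure E) := by
    refine ((integrable_exp_inner_gaussianMeasure (-m)).const_mul (Real.exp c)).mono'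
      (Real.measurable_exp.comp_aemeasurable hi.1.aemeasurable).aestronglyMeasurable
      (Filter.Eventually.of_forall fun g => ?_)
    rw [Real.norm_eq_abs, abs_of_pos (Real.exp_pos _), ← Real.exp_add, Real.exp_le_exp,
      inner_neg_left]
    have := (abs_le.mp (hb (g + m))).2
    nlinarith [sq_nonneg ‖m‖]
  rw [← e1, ← e2]
  exact convexOn_exp.map_integral_le Real.continuous_exp.continuousOn isClosed_univ
    (Filter.Eventually.of_forall fun _ => Set.mem_univ _) hi hexp

end Gaussian
end ShadowSVM
end

/-! ### The PAC-Bayes margin bound and its sample size. -/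

noncomputable section
namespace ShadowSVM
open MeasureTheory

/-- PAC-Bayes margin bound: classifiers of bounded norm with margin one on all data points rarely
misclassify a fresh data point, uniformly over the classifiers. -/
lemma pacBayes_margin {Z E : Type} [Fintype Z] [MeasurableSpace Z] [MeasurableSingletonClass Z]
    [NormedAddCommGroup E] [InnerProductSpace ℝ E] [FiniteDimensional ℝ E]
    (D : Measure Z) [IsProbabilityMeasure D] (ψ : Z → E) {N : ℕ} {Rsq Λsq ε b κ : ℝ}
    (hR : 0 < Rsq) (hψ : ∀ z, ‖ψ z‖ ^ 2 ≤ Rsq) (hb : 0 ≤ b) (hκ : 0 < κ)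
    (hN : Real.log (1 / κ) ≤
      N * (ε / 4 - Real.exp (-(b ^ 2 / (2 * Rsq)))) - b ^ 2 * Λsq / 2) :
    (Measure.pi (fun _ : Fin N => D)).real
      {ω | ∃ w : E, ‖w‖ ^ 2 ≤ Λsq ∧ (∀ l, 1 ≤ inner ℝ w (ψ (ω l))) ∧
        ε < D.real {z | inner ℝ w (ψ z) ≤ 0}} ≤ κ := by
  classical
  borelize E
  set γ := gaussianMeasure E with hγ
  set P := Measure.pi (fun _ : Fin N => D) with hP
  let L : E → ℝ := fun g => ∑ z, D.real {z} * linLoss g (ψ z)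
  -- Halving the true loss is what makes the exponential moment at most one: the loss is 0 or 1 and
  -- `e⁻¹ ≤ 1/2`, so the expectation over one data point is at most `e^(L/2) (1 - L/2) ≤ 1`.
  let H : (Fin N → Z) → E → ℝ := fun ω g => ∑ l, (L g / 2 - linLoss g (ψ (ω l)))
  have hDsum : ∑ z, D.real {z} = 1 := by
    simp
  have hL0 : ∀ g, 0 ≤ L g := fun g =>
    Finset.sum_nonneg fun z _ => mul_nonneg measureReal_nonneg (linLoss_nonneg _ _)
  have hL1 : ∀ g, L g ≤ 1 := fun g => by
    rw [← hDsum]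
    exact Finset.sum_le_sum fun z _ =>
      mul_le_of_le_one_right measureReal_nonneg (linLoss_le_one _ _)
  have hlm : ∀ v : E, Measurable (fun g => linLoss g v) := fun v => by
    simpa using measurable_linLoss (0 : E) v
  have hLm : Measurable L :=
    Finset.measurable_sum _ fun z _ => (hlm _).const_mul _
  have hHm : ∀ ω, Measurable (H ω) := fun ω =>
    Finset.measurable_sum _ fun l _ => (hLm.div_const 2).sub (hlm _)
  have hHb : ∀ ω g, |H ω g| ≤ N := by
    intro ω g
    refine (Finset.abs_sum_le_sum_abs _ _).trans ?_
    have : ∀ l ∈ (Finset.univ : Finset (Fin N)), |L g / 2 - linLoss g (ψ (ω l))| ≤ 1 := by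
      intro l _
      rw [abs_le]
      have h1 := hL0 g
      have h2 := hL1 g
      have h3 := linLoss_nonneg g (ψ (ω l))
      have h4 := linLoss_le_one g (ψ (ω l))
      constructor <;> linarith
    simpa using Finset.sum_le_sum this
  let W : (Fin N → Z) → ℝ := fun ω => ∫ g, Real.exp (H ω g) ∂γ
  have hW0 : ∀ ω, 0 ≤ W ω := fun ω => integral_nonneg fun g => (Real.exp_pos _).le
  have hExpInt : ∀ ω, Integrable (fun g => Real.exp (H ω g)) γ := fun ω =>
    Integrable.of_bound (Real.measurable_exp.comp (hHm ω)).aestronglyMeasurable (Real.exp N)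
      (Filter.Eventually.of_forall fun g => by
        rw [Real.norm_eq_abs, abs_of_pos (Real.exp_pos _), Real.exp_le_exp]
        exact (abs_le.mp (hHb ω g)).2)
  -- the expectation over the data of the exponential moment
  have hone : ∀ g, ∫ z, Real.exp (L g / 2 - linLoss g (ψ z)) ∂D ≤ 1 := by
    intro g
    rw [integral_fintype Integrable.of_finite]
    simp only [smul_eq_mul]
    have h1 : ∀ z, Real.exp (L g / 2 - linLoss g (ψ z)) ≤
        Real.exp (L g / 2) * (1 - linLoss g (ψ z) / 2) := by
      intro z
      rw [sub_eq_add_neg, Real.exp_add]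
      refine mul_le_mul_of_nonneg_left ?_ (Real.exp_pos _).le
      unfold linLoss
      split_ifs
      · rw [Real.exp_neg, inv_le_comm₀ (Real.exp_pos _) (by norm_num)]
        have := Real.add_one_le_exp (1 : ℝ)
        norm_num
        linarith
      · simp
    calc ∑ z, D.real {z} * Real.exp (L g / 2 - linLoss g (ψ z))
        ≤ ∑ z, D.real {z} * (Real.exp (L g / 2) * (1 - linLoss g (ψ z) / 2)) :=
          Finset.sum_le_sum fun z _ => mul_le_mul_of_nonneg_left (h1 z) measureReal_nonneg
      _ = Real.exp (L g / 2) * (∑ z, D.real {z} - L g / 2) := by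
          simp only [L, Finset.sum_div]
          rw [← Finset.sum_sub_distrib, Finset.mul_sum]
          refine Finset.sum_congr rfl fun z _ => ?_
          ring
      _ ≤ Real.exp (L g / 2) * Real.exp (-(L g / 2)) := by
          rw [hDsum]
          refine mul_le_mul_of_nonneg_left ?_ (Real.exp_pos _).le
          linarith [Real.add_one_le_exp (-(L g / 2))]
      _ = 1 := by rw [← Real.exp_add, add_neg_cancel, Real.exp_zero]
  -- The data space is finite, so this exchange is linearity of the Gaussian integral.
  have hswap : ∫ ω, W ω ∂P = ∫ g, ∫ ω, Real.exp (H ω g) ∂P ∂γ := by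
    rw [integral_fintype Integrable.of_finite]
    simp only [integral_fintype (μ := P) Integrable.of_finite, W, smul_eq_mul]
    rw [integral_finsetSum _ fun ω _ => (hExpInt ω).const_mul _]
    simp only [integral_const_mul]
  have hWint : ∫ ω, W ω ∂P ≤ 1 := by
    rw [hswap]
    have h1 : ∀ g, ∫ ω, Real.exp (H ω g) ∂P ≤ 1 := by
      intro g
      simp only [H, Real.exp_sum]
      rw [hP, integral_fintype_prod_eq_prod (fun (_ : Fin N) z =>
        Real.exp (L g / 2 - linLoss g (ψ z)))]
      exact Finset.prod_le_one (fun _ _ => integral_nonneg fun _ => (Real.exp_pos _).le)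
        fun _ _ => hone g
    calc ∫ g, ∫ ω, Real.exp (H ω g) ∂P ∂γ ≤ ∫ _, (1 : ℝ) ∂γ := by
          refine integral_mono_of_nonneg (Filter.Eventually.of_forall fun g =>
            integral_nonneg fun _ => (Real.exp_pos _).le) (integrable_const _)
            (Filter.Eventually.of_forall h1)
      _ = 1 := by simp
  -- on the bad event the exponential moment is large
  have hbad : ∀ ω w, ‖w‖ ^ 2 ≤ Λsq → (∀ l, 1 ≤ inner ℝ w (ψ (ω l))) →
      ε < D.real {z | inner ℝ w (ψ z) ≤ 0} → 1 / κ ≤ W ω := by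
    intro ω w hw hm he
    -- The posterior is centred at `b • w`: scaling by `b` raises the margin on the data to `b`,
    -- which makes the empirical loss exponentially small at an entropy cost of at most `b² Λsq /
    -- 2`.
    have hgibbs := exp_le_integral_exp_gaussianMeasure (hHm ω) (hHb ω) (b • w)
    refine le_trans ?_ hgibbs
    rw [← Real.log_le_iff_le_exp (by positivity)]
    refine hN.trans ?_
    have hLi : Integrable (fun g => L (g + b • w)) γ :=
      integrable_finsetSum _ fun z _ => (integrable_linLoss _ _).const_mul _
    -- Every point misclassified by `w` is misclassified by the randomized classifier with
    -- probability at least one half, so randomization loses at most a factor two.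
    have hLint : ε / 2 ≤ ∫ g, L (g + b • w) ∂γ := by
      simp only [L]
      rw [integral_finsetSum _ fun z _ => (integrable_linLoss _ _).const_mul _]
      simp only [integral_const_mul]
      have hset : D.real {z | inner ℝ w (ψ z) ≤ 0} =
          ∑ z, if inner ℝ w (ψ z) ≤ 0 then D.real {z} else 0 := by
        rw [← Finset.sum_filter, sum_measureReal_singleton]
        simp
      calc ε / 2 ≤ D.real {z | inner ℝ w (ψ z) ≤ 0} / 2 := by linarith
        _ = ∑ z, (if inner ℝ w (ψ z) ≤ 0 then D.real {z} else 0) / 2 := by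
            rw [hset, Finset.sum_div]
        _ ≤ _ := by
            refine Finset.sum_le_sum fun z _ => ?_
            split_ifs with hz
            · rw [div_eq_mul_one_div]
              refine mul_le_mul_of_nonneg_left (half_le_integral_linLoss ?_) measureReal_nonneg
              rw [real_inner_smul_left]
              exact mul_nonpos_of_nonneg_of_nonpos hb hz
            · rw [zero_div]
              exact mul_nonneg measureReal_nonneg (integral_nonneg fun _ => linLoss_nonneg _ _)
    have hemp : ∀ l, ∫ g, linLoss (g + b • w) (ψ (ω l)) ∂γ ≤
        Real.exp (-(b ^ 2 / (2 * Rsq))) := by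
      intro l
      refine integral_linLoss_le hb hR (hψ _) ?_
      rw [real_inner_smul_left]
      exact le_mul_of_one_le_right hb (hm l)
    have hHint : ∫ g, H ω (g + b • w) ∂γ =
        ∑ l, ((∫ g, L (g + b • w) ∂γ) / 2 - ∫ g, linLoss (g + b • w) (ψ (ω l)) ∂γ) := by
      have hi : ∀ l, Integrable (fun g => L (g + b • w) / 2 - linLoss (g + b • w) (ψ (ω l))) γ :=
        fun l => (hLi.div_const 2).sub (integrable_linLoss _ _)
      simp only [H]
      rw [integral_finsetSum _ fun l _ => hi l]
      refine Finset.sum_congr rfl fun l _ => ?_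
      rw [integral_sub (hLi.div_const 2) (integrable_linLoss _ _), integral_div]
    have h1 : (N : ℝ) * (ε / 4 - Real.exp (-(b ^ 2 / (2 * Rsq)))) ≤ ∫ g, H ω (g + b • w) ∂γ := by
      rw [hHint]
      have := Finset.sum_le_sum (s := (Finset.univ : Finset (Fin N)))
        (f := fun _ => ε / 4 - Real.exp (-(b ^ 2 / (2 * Rsq))))
        (g := fun l => (∫ g, L (g + b • w) ∂γ) / 2 - ∫ g, linLoss (g + b • w) (ψ (ω l)) ∂γ)
        fun l _ => by
          have := hemp l
          linarith
      rwa [Finset.sum_const, Finset.card_univ, Fintype.card_fin, nsmul_eq_mul] at this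
    have h2 : ‖b • w‖ ^ 2 ≤ b ^ 2 * Λsq := by
      rw [norm_smul, mul_pow, Real.norm_eq_abs, sq_abs]
      exact mul_le_mul_of_nonneg_left hw (sq_nonneg _)
    linarith
  have hmarkov := mul_meas_ge_le_integral_of_nonneg (μ := P) (f := W)
    (Filter.Eventually.of_forall hW0) Integrable.of_finite (1 / κ)
  have hle : P.real {ω | ∃ w : E, ‖w‖ ^ 2 ≤ Λsq ∧ (∀ l, 1 ≤ inner ℝ w (ψ (ω l))) ∧
        ε < D.real {z | inner ℝ w (ψ z) ≤ 0}} ≤ P.real {ω | 1 / κ ≤ W ω} := by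
    refine measureReal_mono ?_
    rintro ω ⟨w, h1, h2, h3⟩
    exact hbad ω w h1 h2 h3
  refine hle.trans ?_
  have h3 := hmarkov.trans hWint
  rwa [one_div_mul_eq_div, div_le_one hκ] at h3

/-- The sample size of the shadow support vector machine suffices in the margin bound. -/
lemma sampleSize_suffices {N δ ε R Λ : ℝ} (hδ : δ ∈ Set.Ioo (0 : ℝ) 1)
    (hε : ε ∈ Set.Ioo (0 : ℝ) 1) (hRΛ : 1 ≤ R * Λ) (hR : 0 < R)
    (hN : 64 * Λ * R * Real.log (4 / δ) / ε ^ 2 ≤ N) :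
    Real.log (1 / (δ / 4)) ≤
      N * (ε / 4 - Real.exp (-(Real.sqrt (2 * R * Real.log (8 / ε)) ^ 2 / (2 * R)))) -
        Real.sqrt (2 * R * Real.log (8 / ε)) ^ 2 * Λ / 2 := by
  obtain ⟨hδ0, hδ1⟩ := hδ
  obtain ⟨hε0, hε1⟩ := hε
  have hlog8 : 0 ≤ Real.log (8 / ε) := Real.log_nonneg (by rw [le_div_iff₀ hε0]; linarith)
  -- The choice `b² = 2 R log (8/ε)` turns the empirical loss bound into `ε/8`, half of the
  -- available `ε/4`.
  rw [Real.sq_sqrt (by positivity), mul_div_cancel_left₀ _ (by positivity), Real.exp_neg,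
    Real.exp_log (by positivity)]
  have h4 : Real.log 4 ≤ Real.log (4 / δ) :=
    Real.log_le_log (by norm_num) (by rw [le_div_iff₀ hδ0]; nlinarith)
  have hl2 := Real.log_two_gt_d9
  have e4 : Real.log 4 = 2 * Real.log 2 := by
    rw [show (4 : ℝ) = 2 ^ 2 by norm_num, Real.log_pow]; norm_num
  have e8 : Real.log 8 = 3 * Real.log 2 := by
    rw [show (8 : ℝ) = 2 ^ 3 by norm_num, Real.log_pow]; norm_num
  -- Since `log (1/ε) ≤ 1/ε - 1` and `log 8 ≥ 1`. This trades the logarithm for a second factor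
  -- `1/ε`, the source of `ε²` in the sample size.
  have hb : Real.log (8 / ε) ≤ Real.log 8 / ε := by
    rw [div_eq_mul_inv, Real.log_mul (by norm_num) (by positivity), div_eq_mul_inv]
    have h1 := Real.log_le_sub_one_of_pos (inv_pos.mpr hε0)
    have h2 : 1 ≤ ε⁻¹ := (one_le_inv₀ hε0).mpr hε1.le
    nlinarith
  set M := Real.log (4 / δ) with hM
  have hbM : Real.log (8 / ε) ≤ 3 / 2 * M / ε := by
    refine hb.trans ?_
    gcongr
    linarith
  have e1 : 1 / (δ / 4) = 4 / δ := by field_simp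
  rw [e1, ← hM]
  have hMpos : 0 < M := by linarith
  have hNε : 8 * (R * Λ) * (M / ε) ≤ N * (ε / 8) := by
    have := mul_le_mul_of_nonneg_right hN (by positivity : 0 ≤ ε / 8)
    refine le_trans (le_of_eq ?_) this
    field_simp
    ring
  have e2 : N * (ε / 4 - (8 / ε)⁻¹) = N * (ε / 8) := by
    rw [inv_div]; ring
  rw [e2]
  have h5 : R * Λ * Real.log (8 / ε) ≤ R * Λ * (3 / 2 * M / ε) :=
    mul_le_mul_of_nonneg_left hbM (by linarith)
  have h6 : M ≤ M / ε := by rw [le_div_iff₀ hε0]; nlinarith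
  have h7 : M / ε ≤ R * Λ * (M / ε) := le_mul_of_one_le_left (by positivity) hRΛ
  have e3 : R * Λ * (3 / 2 * M / ε) = 3 / 2 * (R * Λ * (M / ε)) := by ring
  have e5 : 2 * R * Real.log (8 / ε) * Λ / 2 = R * Λ * Real.log (8 / ε) := by ring
  have e6 : 8 * (R * Λ) * (M / ε) = 8 * (R * Λ * (M / ε)) := by ring
  rw [e5]
  linarith

end ShadowSVM
end

noncomputable section
namespace ShadowSVM
open Matrix
open scoped MatrixOrder ComplexOrder

/-! ### Positive semidefinite kernels -/

lemma posSemidef_iff_sum {X : Type} [Fintype X] {K : Matrix X X ℝ} :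
    K.PosSemidef ↔ (∀ x y, K x y = K y x) ∧ ∀ a : X → ℝ, 0 ≤ ∑ x, ∑ y, a x * a y * K x y := by
  rw [posSemidef_iff_dotProduct_mulVec]
  have h1 : K.IsHermitian ↔ ∀ x y, K x y = K y x := by
    constructor
    · intro h x y
      simpa using (h.apply x y).symm
    · intro h
      ext x y
      simpa using h y x
  have h2 : ∀ a : X → ℝ, star a ⬝ᵥ (K *ᵥ a) = ∑ x, ∑ y, a x * a y * K x y := by
    intro a
    simp only [dotProduct, mulVec, star_trivial, Finset.mul_sum]
    exact Finset.sum_congr rfl fun x _ => Finset.sum_congr rfl fun y _ => by ring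
  simp only [h1, h2]

lemma quadForm_mono {X : Type} [Fintype X] {K L : Matrix X X ℝ} (h : K ≤ L) (a : X → ℝ) :
    ∑ x, ∑ y, a x * a y * K x y ≤ ∑ x, ∑ y, a x * a y * L x y := by
  have := (posSemidef_iff_sum.mp (Matrix.le_iff.mp h)).2 a
  simp only [Matrix.sub_apply, mul_sub, Finset.sum_sub_distrib] at this
  linarith

/-- The Schur product theorem applies to each summand of `B ⊙ (D - C) + (B - A) ⊙ C`. -/
lemma hadamard_mono {X : Type} {A B C D : Matrix X X ℝ} (hA : 0 ≤ A) (hAB : A ≤ B) (hC : 0 ≤ C)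
    (hCD : C ≤ D) : A ⊙ C ≤ B ⊙ D := by
  have e : B ⊙ D - A ⊙ C = B ⊙ (D - C) + (B - A) ⊙ C := by
    ext x y
    simp only [Matrix.sub_apply, Matrix.add_apply, Matrix.hadamard_apply]
    ring
  rw [Matrix.le_iff, e]
  have h1 : (B ⊙ (D - C) + (B - A) ⊙ C).PosSemidef :=
    ((nonneg_iff_posSemidef.mp (hA.trans hAB)).hadamard (Matrix.le_iff.mp hCD)).add
      ((Matrix.le_iff.mp hAB).hadamard (nonneg_iff_posSemidef.mp hC))
  exact h1

lemma of_one_nonneg {X : Type} [Fintype X] : (0 : Matrix X X ℝ) ≤ Matrix.of fun _ _ => 1 := by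
  rw [nonneg_iff_posSemidef, posSemidef_iff_sum]
  refine ⟨fun _ _ => rfl, fun a => ?_⟩
  simp only [Matrix.of_apply, mul_one, ← Finset.sum_mul_sum]
  exact mul_self_nonneg _

lemma prod_kernel_mono {X ι : Type} [Fintype X] (s : Finset ι) (A B : ι → Matrix X X ℝ)
    (hA : ∀ i ∈ s, 0 ≤ A i) (hAB : ∀ i ∈ s, A i ≤ B i) :
    (0 : Matrix X X ℝ) ≤ (Matrix.of fun x y => ∏ i ∈ s, A i x y) ∧
      (Matrix.of fun x y => ∏ i ∈ s, A i x y) ≤ Matrix.of fun x y => ∏ i ∈ s, B i x y := by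
  classical
  induction s using Finset.induction_on with
  | empty => simpa using of_one_nonneg
  | insert i s hi ih =>
    obtain ⟨h1, h2⟩ := ih (fun j hj => hA j (Finset.mem_insert_of_mem hj))
      (fun j hj => hAB j (Finset.mem_insert_of_mem hj))
    have hAi := hA i (Finset.mem_insert_self _ _)
    have hABi := hAB i (Finset.mem_insert_self _ _)
    have e : ∀ F : ι → Matrix X X ℝ, (Matrix.of fun x y => ∏ j ∈ insert i s, F j x y) =
        F i ⊙ (Matrix.of fun x y => ∏ j ∈ s, F j x y) := by
      intro F
      ext x y
      simp [Finset.prod_insert hi]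
    rw [e, e]
    exact ⟨nonneg_iff_posSemidef.mpr
      ((nonneg_iff_posSemidef.mp hAi).hadamard (nonneg_iff_posSemidef.mp h1)),
      hadamard_mono hAi hABi h1 h2⟩

lemma pow_kernel_nonneg {X : Type} [Fintype X] {A : Matrix X X ℝ} (hA : 0 ≤ A) (d : ℕ) :
    (0 : Matrix X X ℝ) ≤ Matrix.of fun x y => A x y ^ d := by
  have := (prod_kernel_mono (Finset.univ : Finset (Fin d)) (fun _ => A) (fun _ => A)
    (fun _ _ => hA) (fun _ _ => le_rfl)).1
  simpa using this

/-- Each term of the exponential series of a positive semidefinite kernel is dominated by the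
entrywise exponential. -/
lemma pow_div_factorial_le_exp_kernel {X : Type} [Fintype X] {A : Matrix X X ℝ} (hA : 0 ≤ A)
    (d : ℕ) :
    (Matrix.of fun x y => A x y ^ d / (d.factorial : ℝ)) ≤
      Matrix.of fun x y => Real.exp (A x y) := by
  have hs := (posSemidef_iff_sum.mp (nonneg_iff_posSemidef.mp hA)).1
  rw [Matrix.le_iff, posSemidef_iff_sum]
  refine ⟨fun x y => by simp [hs x y], fun a => ?_⟩
  -- Every Taylor term contributes a nonnegative quadratic form, so one term is bounded by all later
  -- partial sums and hence by their limit.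
  have hterm : ∀ e : ℕ, 0 ≤ ∑ x, ∑ y, a x * a y * (A x y ^ e / (e.factorial : ℝ)) := by
    intro e
    have h := (posSemidef_iff_sum.mp (nonneg_iff_posSemidef.mp (pow_kernel_nonneg hA e))).2 a
    have h2 : ∑ x, ∑ y, a x * a y * (A x y ^ e / (e.factorial : ℝ)) =
        (∑ x, ∑ y, a x * a y * (A x y ^ e)) / (e.factorial : ℝ) := by
      simp only [Finset.sum_div, mul_div_assoc]
    rw [h2]
    exact div_nonneg h (by positivity)
  have hlim : Filter.Tendsto (fun M : ℕ => ∑ e ∈ Finset.range M,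
      ∑ x, ∑ y, a x * a y * (A x y ^ e / (e.factorial : ℝ))) Filter.atTop
      (nhds (∑ x, ∑ y, a x * a y * Real.exp (A x y))) := by
    have h1 : ∀ x y, Filter.Tendsto (fun M : ℕ => ∑ e ∈ Finset.range M,
        A x y ^ e / (e.factorial : ℝ)) Filter.atTop (nhds (Real.exp (A x y))) := by
      intro x y
      rw [Real.exp_eq_exp_ℝ]
      exact (NormedSpace.expSeries_div_hasSum_exp (A x y)).tendsto_sum_nat
    have h2 : Filter.Tendsto (fun M : ℕ => ∑ x, ∑ y, a x * a y *
        ∑ e ∈ Finset.range M, A x y ^ e / (e.factorial : ℝ)) Filter.atTop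
        (nhds (∑ x, ∑ y, a x * a y * Real.exp (A x y))) :=
      tendsto_finsetSum _ fun x _ => tendsto_finsetSum _ fun y _ =>
        (h1 x y).const_mul (a x * a y)
    refine h2.congr fun M => ?_
    simp only [Finset.mul_sum]
    symm
    rw [Finset.sum_comm]
    exact Finset.sum_congr rfl fun x _ => Finset.sum_comm
  have hle : ∑ x, ∑ y, a x * a y * (A x y ^ d / (d.factorial : ℝ)) ≤
      ∑ x, ∑ y, a x * a y * Real.exp (A x y) := by
    refine ge_of_tendsto hlim (Filter.eventually_atTop.mpr ⟨d + 1, fun M hM => ?_⟩)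
    have hM' : d < M := hM
    exact Finset.single_le_sum (f := fun e => ∑ x, ∑ y, a x * a y * (A x y ^ e / (e.factorial : ℝ)))
      (fun e _ => hterm e) (Finset.mem_range.mpr hM')
  simp only [Matrix.sub_apply, Matrix.of_apply, mul_sub, Finset.sum_sub_distrib]
  linarith

/-- The average of a kernel over pairs of entries of two sequences. -/
def avgKernel {X : Type} (T : ℕ) (K : Matrix X X ℝ) : Matrix (Fin T → X) (Fin T → X) ℝ :=
  Matrix.of fun S S' => 1 / (T : ℝ) ^ 2 * ∑ t, ∑ t', K (S t) (S' t')

/-- The quadratic form of an averaged kernel at `a` is that of the kernel pulled back along `(S, t)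
↦ S t`, with weights `a S / T`. -/
lemma avgKernel_mono {X : Type} [Fintype X] (T : ℕ) {K L : Matrix X X ℝ} (h : K ≤ L) :
    avgKernel T K ≤ avgKernel T L := by
  classical
  have h1 := posSemidef_iff_sum.mp
    ((Matrix.le_iff.mp h).submatrix (fun p : (Fin T → X) × Fin T => p.1 p.2))
  rw [Matrix.le_iff, posSemidef_iff_sum]
  have h0 := (posSemidef_iff_sum.mp (Matrix.le_iff.mp h)).1
  have e : ∀ S S', (avgKernel T L - avgKernel T K) S S' =
      1 / (T : ℝ) ^ 2 * ∑ t, ∑ t', (L - K) (S t) (S' t') := by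
    intro S S'
    simp only [avgKernel, Matrix.sub_apply, Matrix.of_apply, Finset.sum_sub_distrib, mul_sub]
  refine ⟨fun S S' => ?_, fun a => ?_⟩
  · rw [e, e, Finset.sum_comm]
    congr 1
    exact Finset.sum_congr rfl fun t _ => Finset.sum_congr rfl fun t' _ => h0 _ _
  · have h2 := h1.2 (fun p => a p.1 / T)
    simp only [Fintype.sum_prod_type, Matrix.submatrix_apply] at h2
    refine h2.trans (le_of_eq ?_)
    refine Finset.sum_congr rfl fun S _ => ?_
    rw [Finset.sum_comm]
    refine Finset.sum_congr rfl fun S' _ => ?_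
    rw [e]
    simp only [Finset.mul_sum]
    refine Finset.sum_congr rfl fun t _ => Finset.sum_congr rfl fun t' _ => ?_
    ring

lemma avgKernel_nonneg {X : Type} [Fintype X] (T : ℕ) {K : Matrix X X ℝ} (h : 0 ≤ K) :
    0 ≤ avgKernel T K := by
  have h1 := avgKernel_mono T h
  have h2 : avgKernel T (0 : Matrix X X ℝ) = 0 := by
    ext S S'
    simp [avgKernel]
  rwa [h2] at h1

/-! ### Matrices, tensor products and Frobenius norms -/

lemma isHermitian_pauli (w : Fin 3) : (pauli w).IsHermitian := by
  fin_cases w <;> ext i j <;> fin_cases i <;> fin_cases j <;> simp [pauli]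

lemma isHermitian_proj (s : Outcome) : (proj s).IsHermitian := by
  have h := isHermitian_pauli s.1
  unfold proj
  rw [IsHermitian, conjTranspose_smul, conjTranspose_add, conjTranspose_smul, h.eq]
  simp

lemma isHermitian_factor (s : Outcome) : (factor s).IsHermitian := by
  have h := isHermitian_proj s
  unfold factor
  rw [IsHermitian, conjTranspose_sub, conjTranspose_smul, h.eq]
  simp

lemma isHermitian_tensor {ι : Type} [Fintype ι] {κ : ι → Type}
    {M : (i : ι) → Matrix (κ i) (κ i) ℂ} (h : ∀ i, (M i).IsHermitian) :
    (tensor M).IsHermitian := by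
  ext a b
  simp only [conjTranspose_apply, tensor, star_prod]
  exact Finset.prod_congr rfl fun i _ => (h i).apply _ _

lemma tensor_mul {ι : Type} [Fintype ι] [DecidableEq ι] {κ : ι → Type} [∀ i, Fintype (κ i)]
    (M M' : (i : ι) → Matrix (κ i) (κ i) ℂ) :
    tensor M * tensor M' = tensor fun i => M i * M' i := by
  ext a b
  simp only [Matrix.mul_apply, tensor, Fintype.prod_sum, Finset.prod_mul_distrib]

lemma trace_tensor {ι : Type} [Fintype ι] [DecidableEq ι] {κ : ι → Type} [∀ i, Fintype (κ i)]
    (M : (i : ι) → Matrix (κ i) (κ i) ℂ) : (tensor M).trace = ∏ i, (M i).trace := by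
  simp only [Matrix.trace, Matrix.diag, tensor, Fintype.prod_sum]

lemma trace_mul_eq_ofReal {κ : Type} [Fintype κ] {M M' : Matrix κ κ ℂ} (h : M.IsHermitian)
    (h' : M'.IsHermitian) : (M * M').trace = (((M * M').trace.re : ℝ) : ℂ) := by
  have h1 : star (M * M').trace = (M * M').trace := by
    rw [← Matrix.trace_conjTranspose, conjTranspose_mul, h.eq, h'.eq, Matrix.trace_mul_comm]
  exact (Complex.conj_eq_iff_re.mp h1).symm

/-- The square of the Frobenius norm. -/
def frobSq {κ κ' : Type} [Fintype κ] [Fintype κ'] (M : Matrix κ κ' ℂ) : ℝ :=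
  ∑ p, ∑ q, ‖M p q‖ ^ 2

lemma frobSq_nonneg {κ κ' : Type} [Fintype κ] [Fintype κ'] (M : Matrix κ κ' ℂ) : 0 ≤ frobSq M :=
  Finset.sum_nonneg fun _ _ => Finset.sum_nonneg fun _ _ => sq_nonneg _

lemma frobSq_eq_trace {κ : Type} [Fintype κ] {M : Matrix κ κ ℂ} (h : M.IsHermitian) :
    frobSq M = (M * M).trace.re := by
  simp only [frobSq, Matrix.trace, Matrix.diag, Matrix.mul_apply, Complex.re_sum]
  refine Finset.sum_congr rfl fun p _ => Finset.sum_congr rfl fun q _ => ?_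
  rw [← h.apply q p, Complex.star_def, Complex.mul_conj, Complex.ofReal_re,
    Complex.normSq_eq_norm_sq]

lemma isHermitian_sum_smul {X κ : Type} [Fintype X] {M : X → Matrix κ κ ℂ}
    (h : ∀ x, (M x).IsHermitian) (a : X → ℝ) : (∑ x, (a x : ℂ) • M x).IsHermitian := by
  rw [IsHermitian, conjTranspose_sum]
  refine Finset.sum_congr rfl fun x _ => ?_
  rw [conjTranspose_smul, (h x).eq]
  simp

lemma sum_trace_eq_frobSq {X κ : Type} [Fintype X] [Fintype κ] {M : X → Matrix κ κ ℂ}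
    (h : ∀ x, (M x).IsHermitian) (a : X → ℝ) :
    ∑ x, ∑ y, a x * a y * (M x * M y).trace.re = frobSq (∑ x, (a x : ℂ) • M x) := by
  rw [frobSq_eq_trace (isHermitian_sum_smul h a)]
  simp only [Matrix.sum_mul, Matrix.trace_sum, Complex.re_sum, Matrix.smul_mul,
    Matrix.mul_smul, Matrix.trace_smul, smul_eq_mul, Finset.mul_sum]
  rw [Finset.sum_comm]
  refine Finset.sum_congr rfl fun x _ => Finset.sum_congr rfl fun y _ => ?_
  rw [← mul_assoc, ← Complex.ofReal_mul, Complex.re_ofReal_mul]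
  ring

/-- The quadratic form is the squared Frobenius norm of a linear combination of the `M x`. -/
lemma gram_nonneg {X κ : Type} [Fintype X] [Fintype κ] {M : X → Matrix κ κ ℂ}
    (h : ∀ x, (M x).IsHermitian) :
    (0 : Matrix X X ℝ) ≤ Matrix.of fun x y => (M x * M y).trace.re := by
  rw [nonneg_iff_posSemidef, posSemidef_iff_sum]
  refine ⟨fun x y => by simp [Matrix.trace_mul_comm (M x)], fun a => ?_⟩
  simp only [Matrix.of_apply]
  rw [sum_trace_eq_frobSq h]
  exact frobSq_nonneg _

lemma opNorm_nonneg {κ : Type} [Fintype κ] [DecidableEq κ] (M : Matrix κ κ ℂ) : 0 ≤ opNorm M :=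
  norm_nonneg _

lemma sqrt_sum_mulVec_le {κ : Type} [Fintype κ] [DecidableEq κ] (M : Matrix κ κ ℂ) (u : κ → ℂ) :
    Real.sqrt (∑ p, ‖(M *ᵥ u) p‖ ^ 2) ≤ opNorm M * Real.sqrt (∑ p, ‖u p‖ ^ 2) := by
  have h := (Matrix.toEuclideanCLM (n := κ) (𝕜 := ℂ) M).le_opNorm (WithLp.toLp 2 u)
  rw [EuclideanSpace.norm_eq, EuclideanSpace.norm_eq] at h
  exact h

/-- Each column is the image of a unit vector. The dimension factor becomes the powers of two in the
margin constant. -/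
lemma frobSq_le_opNorm {κ : Type} [Fintype κ] [DecidableEq κ] (M : Matrix κ κ ℂ) :
    frobSq M ≤ Fintype.card κ * opNorm M ^ 2 := by
  have h : ∀ q, ∑ p, ‖M p q‖ ^ 2 ≤ opNorm M ^ 2 := by
    intro q
    have h1 := sqrt_sum_mulVec_le M (Pi.single q 1)
    have h2 : ∑ p, ‖(Pi.single q 1 : κ → ℂ) p‖ ^ 2 = 1 := by
      rw [Finset.sum_eq_single q]
      · simp
      · intro p _ hp
        simp [hp]
      · simp
    rw [h2, Real.sqrt_one, mul_one, Real.sqrt_le_left (opNorm_nonneg M)] at h1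
    simpa using h1
  unfold frobSq
  rw [Finset.sum_comm]
  simpa using Finset.sum_le_sum fun q (_ : q ∈ Finset.univ) => h q

lemma norm_trace_mul_sq_le {κ : Type} [Fintype κ] (M M' : Matrix κ κ ℂ) :
    ‖(M * M').trace‖ ^ 2 ≤ frobSq M * frobSq M' := by
  have h1 : ‖(M * M').trace‖ ≤ ∑ z : κ × κ, ‖M z.1 z.2‖ * ‖M' z.2 z.1‖ := by
    simp only [Matrix.trace, Matrix.diag, Matrix.mul_apply, Fintype.sum_prod_type]
    refine (norm_sum_le _ _).trans (Finset.sum_le_sum fun p _ => (norm_sum_le _ _).trans ?_)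
    exact Finset.sum_le_sum fun q _ => (norm_mul _ _).le
  have h2 := Finset.sum_mul_sq_le_sq_mul_sq Finset.univ (fun z : κ × κ => ‖M z.1 z.2‖)
    (fun z : κ × κ => ‖M' z.2 z.1‖)
  refine (pow_le_pow_left₀ (norm_nonneg _) h1 2).trans (h2.trans (le_of_eq ?_))
  simp only [Fintype.sum_prod_type, frobSq]
  congr 1
  exact Finset.sum_comm

end ShadowSVM
end

noncomputable section
namespace ShadowSVM
open Matrix
open scoped MatrixOrder ComplexOrder

/-! ### The shadow kernel dominates products of reduced shadow kernels -/

/-- The estimate of the reduced density matrix on `A` from a classical shadow. -/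
def shadowState {n T : ℕ} (S : Shadow n T) (A : Finset (Fin n)) : QMatrix {i // i ∈ A} :=
  ((1 / (T : ℝ) : ℝ) : ℂ) • ∑ t, tensor (fun i : {i // i ∈ A} => factor (S t i))

/-- The kernel of single-qubit shadow factors at a site. -/
def siteKernel {n : ℕ} (i : Fin n) : Matrix (Snapshot n) (Snapshot n) ℝ :=
  Matrix.of fun s s' => (factor (s i) * factor (s' i)).trace.re

/-- The product of the site kernels over a set of sites. -/
def subsetKernel {n : ℕ} (A : Finset (Fin n)) : Matrix (Snapshot n) (Snapshot n) ℝ :=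
  Matrix.of fun s u => ∏ i ∈ A, siteKernel i s u

/-- The inner exponential of the shadow kernel. -/
def snapshotKernel (n : ℕ) : Matrix (Snapshot n) (Snapshot n) ℝ :=
  Matrix.of fun s u => Real.exp (1 / (n : ℝ) * ∑ i, siteKernel i s u)

/-- The shadow kernel as a matrix. -/
def shadowKernelMatrix (n T : ℕ) : Matrix (Shadow n T) (Shadow n T) ℝ :=
  Matrix.of (shadowKernel 1 1)

lemma siteKernel_nonneg {n : ℕ} (i : Fin n) : 0 ≤ siteKernel i :=
  gram_nonneg fun s : Snapshot n => isHermitian_factor (s i)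

lemma smul_kernel_nonneg {X : Type} [Fintype X] {c : ℝ} (hc : 0 ≤ c) {K : Matrix X X ℝ}
    (hK : 0 ≤ K) : (0 : Matrix X X ℝ) ≤ Matrix.of fun x y => c * K x y := by
  obtain ⟨h1, h2⟩ := posSemidef_iff_sum.mp (nonneg_iff_posSemidef.mp hK)
  rw [nonneg_iff_posSemidef, posSemidef_iff_sum]
  refine ⟨fun x y => by simp [h1 x y], fun a => ?_⟩
  have : ∑ x, ∑ y, a x * a y * (c * K x y) = c * ∑ x, ∑ y, a x * a y * K x y := by
    simp only [Finset.mul_sum]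
    exact Finset.sum_congr rfl fun x _ => Finset.sum_congr rfl fun y _ => by ring
  simp only [Matrix.of_apply, this]
  exact mul_nonneg hc (h2 a)

lemma subsetKernel_nonneg {n : ℕ} (A : Finset (Fin n)) : 0 ≤ subsetKernel A :=
  (prod_kernel_mono A siteKernel siteKernel (fun i _ => siteKernel_nonneg i)
    (fun _ _ => le_rfl)).1

/-- The exponential of the site average is a product over sites. Keep its linear Taylor term at the
sites of `A` and its constant term elsewhere; the linear terms produce the factor `n ^ (-|A|)`. -/
lemma subsetKernel_le_snapshotKernel {n : ℕ} (A : Finset (Fin n)) :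
    (Matrix.of fun s s' => (1 / (n : ℝ)) ^ A.card * subsetKernel A s s') ≤ snapshotKernel n := by
  let K : Fin n → Matrix (Snapshot n) (Snapshot n) ℝ :=
    fun i => Matrix.of fun s s' => (1 / (n : ℝ)) * siteKernel i s s'
  have hK : ∀ i, 0 ≤ K i := fun i => smul_kernel_nonneg (by positivity) (siteKernel_nonneg i)
  let F : Fin n → Matrix (Snapshot n) (Snapshot n) ℝ :=
    fun i => if i ∈ A then K i else Matrix.of fun _ _ => 1
  have hF : ∀ i, 0 ≤ F i := by
    intro i
    simp only [F]
    split_ifs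
    · exact hK i
    · exact of_one_nonneg
  have hFE : ∀ i, F i ≤ Matrix.of fun s s' => Real.exp (K i s s') := by
    intro i
    simp only [F]
    split_ifs
    · simpa using! pow_div_factorial_le_exp_kernel (hK i) 1
    · simpa using! pow_div_factorial_le_exp_kernel (hK i) 0
  have h := (prod_kernel_mono Finset.univ F (fun i => Matrix.of fun s s' => Real.exp (K i s s'))
    (fun i _ => hF i) (fun i _ => hFE i)).2
  have e1 : (Matrix.of fun s s' => ∏ i, F i s s') =
      Matrix.of fun s s' => (1 / (n : ℝ)) ^ A.card * subsetKernel A s s' := by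
    ext s s'
    have : ∀ i, F i s s' = if i ∈ A then (1 / (n : ℝ)) * siteKernel i s s' else 1 := by
      intro i
      simp only [F]
      split_ifs <;> simp [K]
    simp only [Matrix.of_apply, this, Finset.prod_ite_mem, Finset.univ_inter,
      Finset.prod_mul_distrib, Finset.prod_const, subsetKernel]
  have e2 : (Matrix.of fun s s' => ∏ i, (Matrix.of fun s s' => Real.exp (K i s s')) s s') =
      snapshotKernel n := by
    ext s s'
    simp only [Matrix.of_apply, snapshotKernel, K, ← Real.exp_sum, Finset.mul_sum]
  rwa [e1, e2] at h

lemma shadowKernelMatrix_eq (n T : ℕ) :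
    shadowKernelMatrix n T =
      Matrix.of fun S S' => Real.exp (avgKernel T (snapshotKernel n) S S') := rfl

lemma snapshotKernel_nonneg (n : ℕ) : 0 ≤ snapshotKernel n := by
  refine le_trans ?_ (subsetKernel_le_snapshotKernel (∅ : Finset (Fin n)))
  exact smul_kernel_nonneg (by positivity) (subsetKernel_nonneg _)

lemma shadowKernelMatrix_posSemidef (n T : ℕ) : (shadowKernelMatrix n T).PosSemidef := by
  rw [← nonneg_iff_posSemidef, shadowKernelMatrix_eq]
  have h := pow_div_factorial_le_exp_kernel (avgKernel_nonneg T (snapshotKernel_nonneg n)) 0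
  refine le_trans ?_ h
  simpa using of_one_nonneg

/-- Keep the degree `d` term of the outer exponential and bound its `d` equal factors from below
separately, one subset for each factor. -/
lemma prod_subsetKernel_le_shadowKernelMatrix {n T d : ℕ} (A : Fin d → Finset (Fin n)) :
    (Matrix.of fun S S' => (1 / (d.factorial : ℝ)) *
      ∏ j, ((1 / (n : ℝ)) ^ (A j).card * avgKernel T (subsetKernel (A j)) S S')) ≤
      shadowKernelMatrix n T := by
  rw [shadowKernelMatrix_eq]
  refine le_trans ?_
    (pow_div_factorial_le_exp_kernel (avgKernel_nonneg T (snapshotKernel_nonneg n)) d)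
  let G : Fin d → Matrix (Shadow n T) (Shadow n T) ℝ := fun j =>
    Matrix.of fun S S' => (1 / (n : ℝ)) ^ (A j).card * avgKernel T (subsetKernel (A j)) S S'
  have hG0 : ∀ j, 0 ≤ G j := fun j =>
    smul_kernel_nonneg (by positivity) (avgKernel_nonneg T (subsetKernel_nonneg _))
  have hG : ∀ j, G j ≤ avgKernel T (snapshotKernel n) := by
    intro j
    refine le_trans (le_of_eq ?_) (avgKernel_mono T (subsetKernel_le_snapshotKernel (A j)))
    ext S S'
    simp only [G, avgKernel, Matrix.of_apply, Finset.mul_sum]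
    exact Finset.sum_congr rfl fun t _ => Finset.sum_congr rfl fun t' _ => by ring
  have h := (prod_kernel_mono Finset.univ G (fun _ => avgKernel T (snapshotKernel n))
    (fun j _ => hG0 j) (fun j _ => hG j)).2
  have h1 : (0 : Matrix (Shadow n T) (Shadow n T) ℝ) ≤ Matrix.of fun S S' =>
      (1 / (d.factorial : ℝ)) * ((Matrix.of fun S S' =>
        ∏ _j : Fin d, avgKernel T (snapshotKernel n) S S') - Matrix.of fun S S' =>
        ∏ j, G j S S') S S' :=
    smul_kernel_nonneg (by positivity) (sub_nonneg.mpr h)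
  rw [← sub_nonneg]
  refine h1.trans (le_of_eq ?_)
  ext S S'
  simp only [G, Matrix.of_apply, Matrix.sub_apply, Finset.prod_const, Finset.card_univ,
    Fintype.card_fin]
  ring

lemma isHermitian_shadowState {n T : ℕ} (S : Shadow n T) (A : Finset (Fin n)) :
    (shadowState S A).IsHermitian := by
  unfold shadowState
  rw [IsHermitian, conjTranspose_smul, conjTranspose_sum]
  have : ∀ t, (tensor (fun i : {i // i ∈ A} => factor (S t i)))ᴴ =
      tensor (fun i : {i // i ∈ A} => factor (S t i)) := fun t =>
    isHermitian_tensor fun i => isHermitian_factor _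
  simp only [this]
  rw [Complex.star_def, Complex.conj_ofReal]

lemma prod_trace_eq_ofReal {ι : Type} (s : Finset ι) {κ : ι → Type} [∀ i, Fintype (κ i)]
    {M M' : (i : ι) → Matrix (κ i) (κ i) ℂ} (h : ∀ i, (M i).IsHermitian)
    (h' : ∀ i, (M' i).IsHermitian) :
    ∏ i ∈ s, (M i * M' i).trace = ((∏ i ∈ s, (M i * M' i).trace.re : ℝ) : ℂ) := by
  rw [Complex.ofReal_prod]
  exact Finset.prod_congr rfl fun i _ => trace_mul_eq_ofReal (h i) (h' i)

/-- Traces of tensor products factor over sites, so the averaged subset kernel is the Gram kernel of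
the shadow estimates. -/
lemma avgKernel_subsetKernel {n T : ℕ} (A : Finset (Fin n)) (S S' : Shadow n T) :
    avgKernel T (subsetKernel A) S S' = (shadowState S A * shadowState S' A).trace.re := by
  simp only [shadowState, Matrix.smul_mul, Matrix.mul_smul, Matrix.sum_mul, Matrix.mul_sum,
    Matrix.trace_smul, Matrix.trace_sum, tensor_mul, trace_tensor, smul_eq_mul]
  rw [← Finset.mul_sum, ← mul_assoc, ← Complex.ofReal_mul, Complex.re_ofReal_mul]
  simp only [Complex.re_sum, avgKernel, Matrix.of_apply]
  congr 1
  · ring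
  · rw [Finset.sum_comm]
    refine Finset.sum_congr rfl fun t _ => Finset.sum_congr rfl fun t' _ => ?_
    rw [prod_trace_eq_ofReal _ (fun i => isHermitian_factor _) (fun i => isHermitian_factor _),
      Complex.ofReal_re]
    simp only [subsetKernel, siteKernel, Matrix.of_apply]
    exact (Finset.prod_coe_sort A fun i => (factor (S t' i) * factor (S' t i)).trace.re).symm

/-- The tensor products of the shadow estimates are controlled by the shadow kernel. -/
lemma frobSq_tensor_shadowState_le {n T d : ℕ} (hn : 1 ≤ n) (A : Fin d → Finset (Fin n))
    (a : Shadow n T → ℝ) :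
    frobSq (∑ S, (a S : ℂ) • tensor (fun j => shadowState S (A j))) ≤
      d.factorial * (n : ℝ) ^ (∑ j, (A j).card) *
        ∑ S, ∑ S', a S * a S' * shadowKernelMatrix n T S S' := by
  have hn0 : (0 : ℝ) < n := by exact_mod_cast hn
  rw [← sum_trace_eq_frobSq (fun S => isHermitian_tensor fun j => isHermitian_shadowState S (A j))]
  have h := quadForm_mono (prod_subsetKernel_le_shadowKernelMatrix (T := T) A) a
  have e : ∀ S S' : Shadow n T, (tensor (fun j => shadowState S (A j)) *
      tensor (fun j => shadowState S' (A j))).trace.re =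
      d.factorial * (n : ℝ) ^ (∑ j, (A j).card) * ((1 / (d.factorial : ℝ)) *
      ∏ j, ((1 / (n : ℝ)) ^ (A j).card * avgKernel T (subsetKernel (A j)) S S')) := by
    intro S S'
    rw [tensor_mul, trace_tensor, prod_trace_eq_ofReal _ (fun j => isHermitian_shadowState S (A j))
      (fun j => isHermitian_shadowState S' (A j)), Complex.ofReal_re, Finset.prod_mul_distrib,
      Finset.prod_pow_eq_pow_sum]
    simp only [avgKernel_subsetKernel]
    have : (d.factorial : ℝ) ≠ 0 := by positivity
    rw [_root_.one_div_pow]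
    field_simp
  simp only [e]
  refine le_trans (le_of_eq ?_) (mul_le_mul_of_nonneg_left h
    (by positivity : 0 ≤ (d.factorial : ℝ) * (n : ℝ) ^ (∑ j, (A j).card)))
  simp only [Finset.mul_sum, Matrix.of_apply]
  exact Finset.sum_congr rfl fun S _ => Finset.sum_congr rfl fun S' _ => by ring

/-- The truncated power series of a family of matrices indexed by subsystems. -/
def seriesAt {n r : ℕ} (dp : ℕ) (O : Coefficients n r) (M : ReducedFamily n r) : ℂ :=
  ∑ d ∈ Finset.range (dp + 1), (1 / (d.factorial : ℂ)) *
    ∑ A : Fin d → Subsystem n r, (O d A * tensor (fun j => M (A j))).trace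

/-- By Cauchy-Schwarz in Frobenius norm: the dimension `2 ^ ∑ |A_j|` of the coefficient operator
joins the factor `n ^ ∑ |A_j|` of the kernel comparison to give a power of `2n`. -/
lemma norm_trace_tensor_shadowState_le {n T r d dp : ℕ} (hn : 1 ≤ n) (hd : d ≤ dp)
    (O : Coefficients n r) (A : Fin d → Subsystem n r) (a : Shadow n T → ℝ) :
    ‖(O d A * ∑ S, (a S : ℂ) • tensor (fun j => shadowState S (A j).1)).trace‖ ≤
      opNorm (O d A) * Real.sqrt ((2 * n : ℝ) ^ (r * dp) * dp.factorial *
        ∑ S, ∑ S', a S * a S' * shadowKernelMatrix n T S S') := by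
  have hn1 : (1 : ℝ) ≤ n := by exact_mod_cast hn
  set Q := ∑ S, ∑ S', a S * a S' * shadowKernelMatrix n T S S' with hQ
  have hQ0 : 0 ≤ Q := (posSemidef_iff_sum.mp (shadowKernelMatrix_posSemidef n T)).2 a
  refine abs_le_of_sq_le_sq' ?_ (mul_nonneg (opNorm_nonneg _) (Real.sqrt_nonneg _)) |>.2
  rw [mul_pow, Real.sq_sqrt (by positivity)]
  refine (norm_trace_mul_sq_le _ _).trans ?_
  have h1 := frobSq_le_opNorm (O d A)
  have h2 := frobSq_tensor_shadowState_le hn (fun j => (A j).1) a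
  have hcard : (Fintype.card ((j : Fin d) → ({i // i ∈ (A j).1} → Fin 2)) : ℝ) =
      2 ^ (∑ j, (A j).1.card) := by
    rw [Fintype.card_pi]
    simp [Finset.prod_pow_eq_pow_sum]
  have hexp : ∑ j, (A j).1.card ≤ r * dp := by
    calc ∑ j, (A j).1.card ≤ ∑ _j : Fin d, r := Finset.sum_le_sum fun j _ => (A j).2
      _ = d * r := by simp
      _ ≤ r * dp := by rw [mul_comm]; exact Nat.mul_le_mul_left r hd
  have hpow : (2 * n : ℝ) ^ (∑ j, (A j).1.card) ≤ (2 * n : ℝ) ^ (r * dp) :=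
    pow_le_pow_right₀ (by linarith) hexp
  have hfac : (d.factorial : ℝ) ≤ dp.factorial := by exact_mod_cast Nat.factorial_le hd
  calc _ ≤ (2 ^ (∑ j, (A j).1.card) * opNorm (O d A) ^ 2) *
        (d.factorial * (n : ℝ) ^ (∑ j, (A j).1.card) * Q) := by
        rw [← hcard]
        exact mul_le_mul h1 h2 (frobSq_nonneg _) (by positivity)
    _ = opNorm (O d A) ^ 2 * ((2 * n : ℝ) ^ (∑ j, (A j).1.card) * d.factorial * Q) := by
        rw [mul_pow]; ring
    _ ≤ _ := by gcongr

/-- The truncated power series evaluated at the shadow estimates lies in the reproducing kernel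
Hilbert space of the shadow kernel, with bounded norm. -/
lemma sq_sum_seriesAt_le {n T r dp : ℕ} (hn : 1 ≤ n) (O : Coefficients n r)
    (a : Shadow n T → ℝ) :
    (∑ S, a S * (seriesAt dp O (fun A => shadowState S A.1)).re) ^ 2 ≤
      (2 * n : ℝ) ^ (r * dp) * dp.factorial * normalization dp O ^ 2 *
        ∑ S, ∑ S', a S * a S' * shadowKernelMatrix n T S S' := by
  set Q := ∑ S, ∑ S', a S * a S' * shadowKernelMatrix n T S S' with hQ
  have hQ0 : 0 ≤ Q := (posSemidef_iff_sum.mp (shadowKernelMatrix_posSemidef n T)).2 a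
  set B := (2 * n : ℝ) ^ (r * dp) * dp.factorial * Q with hB
  have hB0 : 0 ≤ B := by positivity
  -- The series is not linear in the shadow estimates, but each summand is linear in their tensor
  -- product, so the sum over shadows moves inside the trace.
  have e1 : ((∑ S, a S * (seriesAt dp O (fun A => shadowState S A.1)).re : ℝ)) =
      (∑ d ∈ Finset.range (dp + 1), (1 / (d.factorial : ℂ)) * ∑ A : Fin d → Subsystem n r,
        (O d A * ∑ S, (a S : ℂ) • tensor (fun j => shadowState S (A j).1)).trace).re := by
    simp only [← Complex.re_ofReal_mul]
    rw [← Complex.re_sum]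
    congr 1
    simp only [seriesAt, Matrix.trace_sum, Matrix.mul_smul, Matrix.trace_smul,
      smul_eq_mul, Finset.mul_sum]
    rw [Finset.sum_comm]
    refine Finset.sum_congr rfl fun d _ => ?_
    rw [Finset.sum_comm]
    exact Finset.sum_congr rfl fun A _ => Finset.sum_congr rfl fun S _ => by ring
  have e2 : |∑ S, a S * (seriesAt dp O (fun A => shadowState S A.1)).re| ≤
      normalization dp O * Real.sqrt B := by
    rw [e1]
    refine (Complex.abs_re_le_norm _).trans ((norm_sum_le _ _).trans ?_)
    rw [normalization, Finset.sum_mul]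
    refine Finset.sum_le_sum fun d hd => ?_
    rw [norm_mul, mul_assoc, Finset.sum_mul]
    have : ‖(1 / (d.factorial : ℂ))‖ = 1 / (d.factorial : ℝ) := by simp
    rw [this]
    refine mul_le_mul_of_nonneg_left ((norm_sum_le _ _).trans (Finset.sum_le_sum fun A _ => ?_))
      (by positivity)
    exact norm_trace_tensor_shadowState_le hn (Nat.lt_succ_iff.mp (Finset.mem_range.mp hd)) O A a
  rw [← sq_abs]
  refine (pow_le_pow_left₀ (abs_nonneg _) e2 2).trans (le_of_eq ?_)
  rw [mul_pow, Real.sq_sqrt hB0, hB]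
  ring

lemma normalization_nonneg {n r : ℕ} (dp : ℕ) (O : Coefficients n r) : 0 ≤ normalization dp O :=
  Finset.sum_nonneg fun _ _ => mul_nonneg (by positivity)
    (Finset.sum_nonneg fun _ _ => opNorm_nonneg _)

lemma sq_dotProduct_two_mul_seriesAt_le {n T r dp : ℕ} (hn : 1 ≤ n) (O : Coefficients n r)
    {C : ℝ} (hC : normalization dp O ≤ C) (a : Shadow n T → ℝ) :
    (a ⬝ᵥ fun S => 2 * (seriesAt dp O (fun A => shadowState S A.1)).re) ^ 2 ≤
      marginSq n r dp C * (a ⬝ᵥ (shadowKernelMatrix n T) *ᵥ a) := by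
  have hn1 : (1 : ℝ) ≤ n := by exact_mod_cast hn
  have hQ0 : 0 ≤ ∑ S, ∑ S', a S * a S' * shadowKernelMatrix n T S S' :=
    (posSemidef_iff_sum.mp (shadowKernelMatrix_posSemidef n T)).2 a
  have e1 : (a ⬝ᵥ fun S => 2 * (seriesAt dp O (fun A => shadowState S A.1)).re) =
      2 * ∑ S, a S * (seriesAt dp O (fun A => shadowState S A.1)).re := by
    simp only [dotProduct, Finset.mul_sum]
    exact Finset.sum_congr rfl fun S _ => by ring
  have e2 : (a ⬝ᵥ (shadowKernelMatrix n T) *ᵥ a) =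
      ∑ S, ∑ S', a S * a S' * shadowKernelMatrix n T S S' := by
    simp only [dotProduct, mulVec, Finset.mul_sum]
    exact Finset.sum_congr rfl fun S _ => Finset.sum_congr rfl fun S' _ => by ring
  rw [e1, e2, mul_pow]
  have h := sq_sum_seriesAt_le (dp := dp) hn O a
  -- For `r = 0` the right base vanishes, but so does the exponent, and both sides are one.
  have h1 : (2 * n : ℝ) ^ (r * dp) ≤ (2 * r * n : ℝ) ^ (r * dp) := by
    rcases Nat.eq_zero_or_pos r with hr | hr
    · simp [hr]
    · have hr1 : (1 : ℝ) ≤ r := by exact_mod_cast hr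
      refine pow_le_pow_left₀ (by positivity) ?_ _
      nlinarith
  have h2 : (dp.factorial : ℝ) ≤ (dp : ℝ) ^ dp := by exact_mod_cast Nat.factorial_le_pow dp
  have h3 : normalization dp O ^ 2 ≤ C ^ 2 := pow_le_pow_left₀ (normalization_nonneg _ _) hC 2
  have h4 : (2 * n : ℝ) ^ (r * dp) * dp.factorial * normalization dp O ^ 2 ≤
      (2 * r * n : ℝ) ^ (r * dp) * (dp : ℝ) ^ dp * C ^ 2 := by gcongr
  have h5 := mul_le_mul_of_nonneg_right h4 hQ0
  unfold marginSq
  nlinarith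

end ShadowSVM
end

noncomputable section
namespace ShadowSVM
open Matrix
open scoped ComplexOrder

/-! ### Trace norm bounds through rank-one decompositions -/

/-- The Euclidean norm of a vector of complex numbers. -/
def vecNorm {κ : Type} [Fintype κ] (u : κ → ℂ) : ℝ := Real.sqrt (∑ p, ‖u p‖ ^ 2)

lemma vecNorm_nonneg {κ : Type} [Fintype κ] (u : κ → ℂ) : 0 ≤ vecNorm u := Real.sqrt_nonneg _

lemma norm_dotProduct_le {κ : Type} [Fintype κ] (u v : κ → ℂ) :
    ‖u ⬝ᵥ v‖ ≤ vecNorm u * vecNorm v := by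
  have h1 : ‖u ⬝ᵥ v‖ ≤ ∑ p, ‖u p‖ * ‖v p‖ :=
    (norm_sum_le _ _).trans (Finset.sum_le_sum fun p _ => (norm_mul _ _).le)
  exact h1.trans (Real.sum_mul_le_sqrt_mul_sqrt _ _ _)

lemma vecNorm_prod {ι : Type} [Fintype ι] [DecidableEq ι] {κ : ι → Type} [∀ i, Fintype (κ i)]
    (u : (i : ι) → κ i → ℂ) :
    vecNorm (fun p : (i : ι) → κ i => ∏ i, u i (p i)) = ∏ i, vecNorm (u i) := by
  unfold vecNorm
  rw [Real.sqrt_eq_iff_mul_self_eq (Finset.sum_nonneg fun _ _ => sq_nonneg _)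
    (Finset.prod_nonneg fun _ _ => Real.sqrt_nonneg _), ← Finset.prod_mul_distrib]
  have : ∀ i, Real.sqrt (∑ p, ‖u i p‖ ^ 2) * Real.sqrt (∑ p, ‖u i p‖ ^ 2) =
      ∑ p, ‖u i p‖ ^ 2 := fun i =>
    Real.mul_self_sqrt (Finset.sum_nonneg fun _ _ => sq_nonneg _)
  simp only [this, Fintype.prod_sum, norm_prod, Finset.prod_pow]

/-- The trace norm of `M` is at most `a`, witnessed by a decomposition into rank-one matrices. -/
def TraceNormLE {κ : Type} [Fintype κ] (M : Matrix κ κ ℂ) (a : ℝ) : Prop :=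
  ∃ (ι : Type) (_ : Fintype ι) (u v : ι → κ → ℂ),
    (∀ p q, M p q = ∑ i, u i p * v i q) ∧ ∑ i, vecNorm (u i) * vecNorm (v i) ≤ a

lemma TraceNormLE.mono {κ : Type} [Fintype κ] {M : Matrix κ κ ℂ} {a b : ℝ}
    (h : TraceNormLE M a) (hab : a ≤ b) : TraceNormLE M b := by
  obtain ⟨ι, hι, u, v, h1, h2⟩ := h
  exact ⟨ι, hι, u, v, h1, h2.trans hab⟩

lemma TraceNormLE.norm_trace_mul_le {κ : Type} [Fintype κ] [DecidableEq κ] {M : Matrix κ κ ℂ}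
    {a : ℝ} (h : TraceNormLE M a) (O : Matrix κ κ ℂ) : ‖(O * M).trace‖ ≤ opNorm O * a := by
  obtain ⟨ι, hι, u, v, h1, h2⟩ := h
  have e : (O * M).trace = ∑ i, v i ⬝ᵥ (O *ᵥ u i) := by
    simp only [Matrix.trace, Matrix.diag, Matrix.mul_apply, h1, dotProduct, mulVec, Finset.mul_sum]
    symm
    rw [Finset.sum_comm]
    refine Finset.sum_congr rfl fun p _ => ?_
    rw [Finset.sum_comm]
    exact Finset.sum_congr rfl fun q _ => Finset.sum_congr rfl fun i _ => by ring
  rw [e]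
  calc ‖∑ i, v i ⬝ᵥ (O *ᵥ u i)‖ ≤ ∑ i, opNorm O * (vecNorm (u i) * vecNorm (v i)) := by
        refine (norm_sum_le _ _).trans (Finset.sum_le_sum fun i _ => ?_)
        have h3 := norm_dotProduct_le (v i) (O *ᵥ u i)
        have h4 : vecNorm (O *ᵥ u i) ≤ opNorm O * vecNorm (u i) := sqrt_sum_mulVec_le O (u i)
        nlinarith [mul_le_mul_of_nonneg_left h4 (vecNorm_nonneg (v i))]
    _ ≤ opNorm O * a := by
        rw [← Finset.mul_sum]
        exact mul_le_mul_of_nonneg_left h2 (opNorm_nonneg O)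

/-- Tensor products of rank-one matrices have rank one, and their vector norms multiply. -/
lemma TraceNormLE.tensor {ι : Type} [Fintype ι] [DecidableEq ι] {κ : ι → Type}
    [∀ i, Fintype (κ i)] {M : (i : ι) → Matrix (κ i) (κ i) ℂ} {a : ι → ℝ}
    (h : ∀ i, TraceNormLE (M i) (a i)) : TraceNormLE (ShadowSVM.tensor M) (∏ i, a i) := by
  choose κ' hκ' u v h1 h2 using h
  refine ⟨(i : ι) → κ' i, inferInstance, fun k p => ∏ i, u i (k i) (p i),
    fun k q => ∏ i, v i (k i) (q i), fun p q => ?_, ?_⟩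
  · simp only [ShadowSVM.tensor, h1, Fintype.prod_sum, Finset.prod_mul_distrib]
  · have e : ∀ k : (i : ι) → κ' i, vecNorm (fun p : (i : ι) → κ i => ∏ i, u i (k i) (p i)) *
        vecNorm (fun q : (i : ι) → κ i => ∏ i, v i (k i) (q i)) =
        ∏ i, vecNorm (u i (k i)) * vecNorm (v i (k i)) := by
      intro k
      rw [vecNorm_prod, vecNorm_prod, Finset.prod_mul_distrib]
    simp only [e]
    rw [← Fintype.prod_sum (fun i k => vecNorm (u i k) * vecNorm (v i k))]
    exact Finset.prod_le_prod (fun i _ => Finset.sum_nonneg fun k _ =>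
      mul_nonneg (vecNorm_nonneg _) (vecNorm_nonneg _)) fun i _ => h2 i

/-- Write `M = B* B` and decompose along the rows of `B`; the cost is the squared Frobenius norm of
`B`, which is the trace. -/
lemma traceNormLE_of_posSemidef {κ : Type} [Fintype κ] [DecidableEq κ] {M : Matrix κ κ ℂ}
    (h : M.PosSemidef) : TraceNormLE M M.trace.re := by
  open scoped MatrixOrder in
  obtain ⟨B, hB⟩ := CStarAlgebra.nonneg_iff_eq_star_mul_self.mp h.nonneg
  refine ⟨κ, inferInstance, fun i p => star (B i p), fun i q => B i q, fun p q => ?_, le_of_eq ?_⟩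
  · rw [hB]
    simp [Matrix.mul_apply]
  · have e : ∀ i, vecNorm (fun p => star (B i p)) * vecNorm (fun q => B i q) =
        ∑ p, ‖B i p‖ ^ 2 := by
      intro i
      simp only [vecNorm, norm_star]
      exact Real.mul_self_sqrt (Finset.sum_nonneg fun _ _ => sq_nonneg _)
    simp only [e]
    rw [Finset.sum_comm, hB]
    simp only [Matrix.trace, Matrix.diag, Matrix.mul_apply, Matrix.star_apply, Complex.re_sum]
    refine Finset.sum_congr rfl fun p _ => Finset.sum_congr rfl fun i _ => ?_
    rw [mul_comm, Complex.star_def, Complex.mul_conj, Complex.ofReal_re, Complex.normSq_eq_norm_sq]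

/-- Decompose into columns and apply Cauchy-Schwarz to the sum of their norms. -/
lemma traceNormLE_frobSq {κ : Type} [Fintype κ] [DecidableEq κ] (M : Matrix κ κ ℂ) :
    TraceNormLE M (Real.sqrt (Fintype.card κ * frobSq M)) := by
  refine ⟨κ, inferInstance, fun i p => M p i, fun i => Pi.single i 1, fun p q => ?_, ?_⟩
  · rw [Finset.sum_eq_single q]
    · simp
    · intro i _ hi
      simp [hi.symm]
    · simp
  · have e : ∀ i : κ, vecNorm (Pi.single i 1 : κ → ℂ) = 1 := by
      intro i
      unfold vecNorm
      rw [Finset.sum_eq_single i]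
      · simp
      · intro p _ hp
        simp [hp]
      · simp
    simp only [e, mul_one]
    have h := Real.sum_mul_le_sqrt_mul_sqrt Finset.univ (fun _ : κ => (1 : ℝ))
      (fun i => vecNorm fun p => M p i)
    simp only [one_mul, one_pow, Finset.sum_const, Finset.card_univ, nsmul_eq_mul, mul_one] at h
    refine h.trans (le_of_eq ?_)
    rw [Real.sqrt_mul (Nat.cast_nonneg _)]
    congr 2
    unfold frobSq
    rw [Finset.sum_comm]
    exact Finset.sum_congr rfl fun i _ =>
      Real.sq_sqrt (Finset.sum_nonneg fun _ _ => sq_nonneg _)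

/-! ### Reduced density matrices -/

lemma reduced_posSemidef {n : ℕ} {ρ : QMatrix (Fin n)} (hρ : ρ.PosSemidef) (A : Finset (Fin n)) :
    (reduced ρ A).PosSemidef := by
  have e : reduced ρ A = ∑ c : {i // i ∉ A} → Fin 2, ρ.submatrix
      (fun a => (Equiv.piEquivPiSubtypeProd (fun i => i ∈ A) (fun _ => Fin 2)).symm (a, c))
      (fun a => (Equiv.piEquivPiSubtypeProd (fun i => i ∈ A) (fun _ => Fin 2)).symm (a, c)) := by
    ext a b
    simp [reduced, Matrix.sum_apply]
  rw [e]
  exact posSemidef_sum _ fun c _ => hρ.submatrix _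

lemma trace_reduced {n : ℕ} (ρ : QMatrix (Fin n)) (A : Finset (Fin n)) :
    (reduced ρ A).trace = ρ.trace := by
  simp only [Matrix.trace, Matrix.diag, reduced]
  rw [← (Equiv.piEquivPiSubtypeProd (fun i => i ∈ A) (fun _ => Fin 2)).symm.sum_comp,
    Fintype.sum_prod_type]

lemma traceNormLE_reduced {n : ℕ} (ρ : State n) (A : Finset (Fin n)) :
    TraceNormLE (reduced ρ.1 A) 1 := by
  have h := traceNormLE_of_posSemidef (reduced_posSemidef ρ.2.1 A)
  rwa [trace_reduced, ρ.2.2, Complex.one_re] at h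

/-! ### Stability of the truncated power series -/

/-- Expand the tensor product over the choices of `M j` or `Δ j` at each factor. The all-`false`
choice is the subtracted term; the costs of the others sum to `(1 + e) ^ d - 1`. -/
lemma norm_trace_tensor_sub_le {d : ℕ} {κ : Fin d → Type} [∀ j, Fintype (κ j)]
    [∀ j, DecidableEq (κ j)] {M Δ : (j : Fin d) → Matrix (κ j) (κ j) ℂ} {e : ℝ}
    (hM : ∀ j, TraceNormLE (M j) 1) (hΔ : ∀ j, TraceNormLE (Δ j) e)
    (O : Matrix ((j : Fin d) → κ j) ((j : Fin d) → κ j) ℂ) :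
    ‖(O * tensor (fun j => M j + Δ j)).trace - (O * tensor M).trace‖ ≤
      opNorm O * ((1 + e) ^ d - 1) := by
  have e1 : tensor (fun j => M j + Δ j) =
      ∑ b : Fin d → Bool, tensor (fun j => if b j then Δ j else M j) := by
    ext p q
    rw [Matrix.sum_apply]
    simp only [tensor, Matrix.add_apply]
    rw [← Fintype.prod_sum (fun j (b : Bool) => (if b then Δ j else M j) (p j) (q j))]
    refine Finset.prod_congr rfl fun j _ => ?_
    simp [add_comm]
  have e2 : (1 + e) ^ d = ∑ b : Fin d → Bool, ∏ j, if b j then e else 1 := by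
    rw [← Fintype.prod_sum (fun _ (b : Bool) => if b then e else 1)]
    simp [add_comm]
  have h1 : ∀ b : Fin d → Bool, ‖(O * tensor (fun j => if b j then Δ j else M j)).trace‖ ≤
      opNorm O * ∏ j, if b j then e else 1 := by
    intro b
    refine TraceNormLE.norm_trace_mul_le (TraceNormLE.tensor fun j => ?_) O
    split_ifs
    · exact hΔ j
    · exact hM j
  have hm : (fun _ => false) ∈ (Finset.univ : Finset (Fin d → Bool)) := Finset.mem_univ _
  rw [e1, e2, Matrix.mul_sum, Matrix.trace_sum, ← Finset.add_sum_erase _ _ hm,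
    ← Finset.add_sum_erase _ _ hm]
  simp only [Bool.false_eq_true, if_false, Finset.prod_const_one, add_sub_cancel_left]
  rw [Finset.mul_sum]
  exact (norm_sum_le _ _).trans (Finset.sum_le_sum fun b _ => h1 b)

lemma norm_seriesAt_sub_powerSeries_le {n r dp : ℕ} (O : Coefficients n r) (ρ : State n)
    (σ : ReducedFamily n r) {e : ℝ} (he : 0 ≤ e)
    (hσ : ∀ A, TraceNormLE (σ A - reduced ρ.1 A.1) e) :
    ‖seriesAt dp O σ - powerSeries dp O ρ‖ ≤ normalization dp O * ((1 + e) ^ dp - 1) := by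
  rw [seriesAt, powerSeries, ← Finset.sum_sub_distrib, normalization, Finset.sum_mul]
  refine (norm_sum_le _ _).trans (Finset.sum_le_sum fun d hd => ?_)
  have hd' : d ≤ dp := Nat.lt_succ_iff.mp (Finset.mem_range.mp hd)
  rw [← mul_sub, norm_mul, mul_assoc, Finset.sum_mul, ← Finset.sum_sub_distrib]
  have : ‖(1 / (d.factorial : ℂ))‖ = 1 / (d.factorial : ℝ) := by simp
  rw [this]
  refine mul_le_mul_of_nonneg_left ((norm_sum_le _ _).trans (Finset.sum_le_sum fun A _ => ?_))
    (by positivity)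
  have h := norm_trace_tensor_sub_le (fun j => traceNormLE_reduced ρ (A j).1)
    (fun j => hσ (A j)) (O d A)
  simp only [add_sub_cancel] at h
  refine h.trans (mul_le_mul_of_nonneg_left ?_ (opNorm_nonneg _))
  exact sub_le_sub_right (pow_le_pow_right₀ (by linarith) hd') 1

lemma norm_powerSeries_le {n r : ℕ} (dp : ℕ) (O : Coefficients n r) (ρ : State n) :
    ‖powerSeries dp O ρ‖ ≤ normalization dp O := by
  refine (norm_sum_le _ _).trans (Finset.sum_le_sum fun d _ => ?_)
  rw [norm_mul]
  have : ‖(1 / (d.factorial : ℂ))‖ = 1 / (d.factorial : ℝ) := by simp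
  rw [this]
  refine mul_le_mul_of_nonneg_left ((norm_sum_le _ _).trans (Finset.sum_le_sum fun A _ => ?_))
    (by positivity)
  simpa using (TraceNormLE.tensor fun j => traceNormLE_reduced ρ (A j).1).norm_trace_mul_le (O d A)

/-- The power is at most `e^x` with `x = 3/(16C) ≤ 1/4`, and `e^x - 1 ≤ x + x² ≤ 5x/4`. This gives
`15/64`, just below the allowed `1/4`. -/
lemma mul_one_add_pow_sub_one_le {C : ℝ} (hC : 3 / 4 ≤ C) {dp : ℕ} (hdp : 1 ≤ dp) :
    C * ((1 + 3 / (16 * dp * C)) ^ dp - 1) ≤ 1 / 4 := by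
  have hdp' : (1 : ℝ) ≤ dp := by exact_mod_cast hdp
  have hC0 : 0 < C := by linarith
  set x : ℝ := 3 / (16 * C) with hx
  have hx0 : 0 ≤ x := by positivity
  have hx1 : x ≤ 1 / 4 := by
    rw [hx, div_le_iff₀ (by positivity)]; linarith
  have h1 : (1 + 3 / (16 * dp * C)) ^ dp ≤ Real.exp x := by
    have h2 : 1 + 3 / (16 * dp * C) ≤ Real.exp (3 / (16 * dp * C)) := by
      linarith [Real.add_one_le_exp (3 / (16 * dp * C))]
    refine (pow_le_pow_left₀ (by positivity) h2 dp).trans (le_of_eq ?_)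
    rw [← Real.exp_nat_mul]
    congr 1
    rw [hx]; field_simp
  have h2 := (abs_le.mp (Real.abs_exp_sub_one_sub_id_le (x := x)
    (by rw [abs_of_nonneg hx0]; linarith))).2
  have h3 : C * x = 3 / 16 := by rw [hx]; field_simp
  nlinarith

end ShadowSVM
end

noncomputable section
namespace ShadowSVM
open Matrix
open scoped ComplexOrder

/-! ### Pauli strings -/

/-- The identity and the Pauli matrices. -/
def pauliBasis : Option (Fin 3) → Matrix (Fin 2) (Fin 2) ℂ
  | none => 1
  | some w => pauli w

lemma isHermitian_pauliBasis (q : Option (Fin 3)) : (pauliBasis q).IsHermitian := by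
  cases q with
  | none => exact isHermitian_one
  | some w => exact isHermitian_pauli w

/-- Completeness of the Pauli basis: the sum of `P ⊗ P` is twice the swap operator. Parseval's
identity rests on it. -/
lemma sum_pauliBasis_mul (a b c d : Fin 2) :
    ∑ q, pauliBasis q a b * pauliBasis q c d = if a = d ∧ b = c then 2 else 0 := by
  rw [Fintype.sum_option, Fin.sum_univ_three]
  fin_cases a <;> fin_cases b <;> fin_cases c <;> fin_cases d <;>
    simp [pauliBasis, pauli, one_add_one_eq_two]

/-- The tensor product of Pauli matrices. -/
def pauliString {ι : Type} [Fintype ι] (Q : ι → Option (Fin 3)) : QMatrix ι :=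
  tensor fun i => pauliBasis (Q i)

lemma sum_pauliString_mul {ι : Type} [Fintype ι] [DecidableEq ι] (a b c d : ι → Fin 2) :
    ∑ Q : ι → Option (Fin 3), pauliString Q a b * pauliString Q c d =
      if a = d ∧ b = c then 2 ^ Fintype.card ι else 0 := by
  simp only [pauliString, tensor, ← Finset.prod_mul_distrib]
  rw [← Fintype.prod_sum (fun i q => pauliBasis q (a i) (b i) * pauliBasis q (c i) (d i))]
  simp only [sum_pauliBasis_mul]
  split_ifs with h
  · obtain ⟨rfl, rfl⟩ := h
    simp
  · have : ∃ i, ¬ (a i = d i ∧ b i = c i) := by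
      by_contra! hc
      exact h ⟨funext fun i => (hc i).1, funext fun i => (hc i).2⟩
    obtain ⟨i, hi⟩ := this
    exact Finset.prod_eq_zero (Finset.mem_univ i) (if_neg hi)

/-- Parseval's identity for the Pauli basis. -/
lemma sum_norm_trace_pauliString_sq {ι : Type} [Fintype ι] [DecidableEq ι] (M : QMatrix ι) :
    ∑ Q : ι → Option (Fin 3), ‖(pauliString Q * M).trace‖ ^ 2 =
      2 ^ Fintype.card ι * frobSq M := by
  have hherm : ∀ (Q : ι → Option (Fin 3)) c d, star (pauliString Q c d) = pauliString Q d c :=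
    fun Q c d => (isHermitian_tensor fun i => isHermitian_pauliBasis (Q i)).apply d c
  have h1 : ∀ Q : ι → Option (Fin 3), ((‖(pauliString Q * M).trace‖ ^ 2 : ℝ) : ℂ) =
      ∑ a, ∑ b, ∑ c, ∑ d, (pauliString Q c d * pauliString Q b a) * (M d c * star (M b a)) := by
    intro Q
    rw [← Complex.normSq_eq_norm_sq, ← Complex.mul_conj, ← Complex.star_def]
    simp only [Matrix.trace, Matrix.diag, Matrix.mul_apply, star_sum, star_mul', hherm]
    simp only [Finset.sum_mul, Finset.mul_sum]
    exact Finset.sum_congr rfl fun a _ => Finset.sum_congr rfl fun b _ =>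
      Finset.sum_congr rfl fun c _ => Finset.sum_congr rfl fun d _ => by ring
  apply Complex.ofReal_injective
  rw [Complex.ofReal_sum]
  simp only [h1]
  have h2 : ∀ a b : ι → Fin 2, ∑ c, ∑ d, ∑ Q : ι → Option (Fin 3),
      (pauliString Q c d * pauliString Q b a) * (M d c * star (M b a)) =
      2 ^ Fintype.card ι * (M b a * star (M b a)) := by
    intro a b
    simp only [← Finset.sum_mul, sum_pauliString_mul]
    rw [Finset.sum_eq_single a, Finset.sum_eq_single b]
    · simp
    · intro d _ hd
      rw [if_neg (fun h => hd h.2), zero_mul]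
    · simp
    · intro c _ hc
      refine Finset.sum_eq_zero fun d _ => ?_
      rw [if_neg (fun h => hc h.1), zero_mul]
    · simp
  rw [Finset.sum_comm]
  have h3 : ∀ a : ι → Fin 2, ∑ Q : ι → Option (Fin 3), ∑ b, ∑ c, ∑ d,
      (pauliString Q c d * pauliString Q b a) * (M d c * star (M b a)) =
      ∑ b, 2 ^ Fintype.card ι * (M b a * star (M b a)) := by
    intro a
    rw [Finset.sum_comm]
    refine Finset.sum_congr rfl fun b _ => ?_
    rw [← h2, Finset.sum_comm]
    refine Finset.sum_congr rfl fun c _ => ?_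
    rw [Finset.sum_comm]
  simp only [h3]
  unfold frobSq
  push_cast
  simp only [Finset.mul_sum]
  rw [Finset.sum_comm]
  refine Finset.sum_congr rfl fun b _ => Finset.sum_congr rfl fun a _ => ?_
  rw [Complex.star_def, Complex.mul_conj, Complex.normSq_eq_norm_sq]
  push_cast
  rfl

/-! ### Born's rule -/

lemma tensor_smul_sum {ι κ : Type} [Fintype ι] [DecidableEq ι] [Fintype κ]
    (c : ι → κ → ℂ) (M : ι → κ → Matrix (Fin 2) (Fin 2) ℂ) :
    tensor (fun i => ∑ o, c i o • M i o) =
      ∑ s : ι → κ, (∏ i, c i (s i)) • tensor (fun i => M i (s i)) := by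
  ext a b
  simp only [tensor, Matrix.sum_apply, Matrix.smul_apply, smul_eq_mul, Fintype.prod_sum,
    Finset.prod_mul_distrib]

/-- Reduces moments of product functions of a snapshot to single-qubit operator identities. -/
lemma sum_bornProb_mul_prod {n : ℕ} (ρ : State n) (h : Fin n → Outcome → ℝ) :
    ∑ s, bornProb ρ s * ∏ i, h i (s i) =
      (tensor (fun i => ∑ o, ((1 / 3 * h i o : ℝ) : ℂ) • proj o) * ρ.1).trace.re := by
  rw [tensor_smul_sum]
  simp only [Matrix.sum_mul, Matrix.trace_sum, Complex.re_sum, Matrix.smul_mul, Matrix.trace_smul,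
    smul_eq_mul, ← Complex.ofReal_prod, Complex.re_ofReal_mul]
  refine Finset.sum_congr rfl fun s _ => ?_
  simp only [bornProb, Finset.prod_mul_distrib, Finset.prod_const, Finset.card_univ,
    Fintype.card_fin]
  ring

lemma pauli_mul_self (w : Fin 3) : pauli w * pauli w = 1 := by
  fin_cases w <;> ext i j <;> fin_cases i <;> fin_cases j <;>
    simp [pauli, Matrix.mul_apply, Fin.sum_univ_two]

lemma pm_mul_self (b : Bool) : pm b * pm b = 1 := by
  cases b <;> simp [pm]

lemma proj_mul_self (s : Outcome) : proj s * proj s = proj s := by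
  have h1 := pauli_mul_self s.1
  have h2 : ((pm s.2 : ℝ) : ℂ) * (pm s.2 : ℝ) = 1 := by
    rw [← Complex.ofReal_mul, pm_mul_self, Complex.ofReal_one]
  have h3 : (((pm s.2 : ℝ) : ℂ) • pauli s.1) * (((pm s.2 : ℝ) : ℂ) • pauli s.1) = 1 := by
    rw [Matrix.smul_mul, Matrix.mul_smul, smul_smul, h1, h2, one_smul]
  unfold proj
  rw [Matrix.smul_mul, Matrix.mul_smul, smul_smul, Matrix.add_mul, Matrix.mul_add, Matrix.mul_add,
    h3]
  simp only [Matrix.one_mul, Matrix.mul_one]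
  ext i j
  simp only [Matrix.smul_apply, Matrix.add_apply, smul_eq_mul]
  ring

/-- The product projector `H` satisfies `tr (H ρ) = tr (H ρ Hᴴ)`, the trace of a positive
semidefinite matrix. -/
lemma bornProb_nonneg {n : ℕ} (ρ : State n) (s : Snapshot n) : 0 ≤ bornProb ρ s := by
  set H := tensor (fun i => proj (s i)) with hH
  have h1 : Hᴴ = H := isHermitian_tensor fun i => isHermitian_proj (s i)
  have h2 : H * H = H := by
    rw [hH, tensor_mul]
    simp only [proj_mul_self]
  have h3 : 0 ≤ (H * ρ.1 * Hᴴ).trace := (ρ.2.1.mul_mul_conjTranspose_same H).trace_nonneg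
  rw [h1, Matrix.trace_mul_comm, ← Matrix.mul_assoc, h2] at h3
  exact mul_nonneg (by positivity) (Complex.le_def.mp h3).1

/-- The Pauli coefficient of a single-qubit shadow factor. -/
def pauliCoeff : Option (Fin 3) → Outcome → ℝ
  | none, _ => 1
  | some w, o => if w = o.1 then 3 * pm o.2 else 0

lemma factor_apply (s : Outcome) (i j : Fin 2) :
    factor s i j = 3 / 2 * pm s.2 * pauli s.1 i j + 1 / 2 * (1 : Matrix (Fin 2) (Fin 2) ℂ) i j := by
  simp only [factor, proj, Matrix.sub_apply, Matrix.smul_apply, Matrix.add_apply, smul_eq_mul]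
  ring

lemma trace_pauliBasis_mul_factor (q : Option (Fin 3)) (o : Outcome) :
    (pauliBasis q * factor o).trace = (pauliCoeff q o : ℂ) := by
  obtain ⟨w', b⟩ := o
  simp only [Matrix.trace, Matrix.diag, Matrix.mul_apply, Fin.sum_univ_two, factor_apply]
  rcases q with _ | w
  · fin_cases w' <;> simp [pauliBasis, pauliCoeff, pauli] <;> ring
  · fin_cases w <;> fin_cases w' <;> simp [pauliBasis, pauliCoeff, pauli] <;> ring_nf <;> simp

/-- Single-qubit unbiasedness: the factor three in the coefficient compensates for measuring the
matching basis only one third of the time. -/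
lemma sum_pauliCoeff_smul_proj (q : Option (Fin 3)) :
    ∑ o, ((1 / 3 * pauliCoeff q o : ℝ) : ℂ) • proj o = pauliBasis q := by
  rw [Fintype.sum_prod_type, Fin.sum_univ_three]
  simp only [Fintype.sum_bool]
  rcases q with _ | w
  · ext i j
    fin_cases i <;> fin_cases j <;> simp [pauliBasis, pauliCoeff, proj, pauli, pm] <;> ring
  · fin_cases w <;> ext i j <;> fin_cases i <;> fin_cases j <;>
      simp [pauliBasis, pauliCoeff, proj, pauli, pm] <;> ring

/-- The second moment of the Pauli coefficient of a shadow factor. -/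
def pauliWeight : Option (Fin 3) → ℝ
  | none => 1
  | some _ => 3

/-- For a Pauli matrix the squared coefficient is nine in one basis out of three, whatever the
outcome. The resulting operator is scalar, so the second moment does not depend on the state. -/
lemma sum_pauliCoeff_sq_smul_proj (q : Option (Fin 3)) :
    ∑ o, ((1 / 3 * pauliCoeff q o ^ 2 : ℝ) : ℂ) • proj o = (pauliWeight q : ℂ) • 1 := by
  rw [Fintype.sum_prod_type, Fin.sum_univ_three]
  simp only [Fintype.sum_bool]
  rcases q with _ | w
  · ext i j
    fin_cases i <;> fin_cases j <;> simp [pauliWeight, pauliCoeff, proj, pauli, pm] <;> ring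
  · fin_cases w <;> ext i j <;> fin_cases i <;> fin_cases j <;>
      simp [pauliWeight, pauliCoeff, proj, pauli, pm] <;> ring

lemma sum_bornProb {n : ℕ} (ρ : State n) : ∑ s, bornProb ρ s = 1 := by
  have h := sum_bornProb_mul_prod ρ (fun _ o => pauliCoeff none o)
  simp only [sum_pauliCoeff_smul_proj] at h
  have e : tensor (fun _ : Fin n => pauliBasis none) = (1 : QMatrix (Fin n)) := by
    ext a b
    simp only [tensor, pauliBasis, Matrix.one_apply, Finset.prod_ite_zero, Finset.prod_const_one,
      funext_iff, Finset.mem_univ, true_implies]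
  rw [e, Matrix.one_mul, ρ.2.2, Complex.one_re] at h
  simpa [pauliCoeff] using h

/-- Duality between tensoring with the identity and the partial trace. -/
lemma trace_tensor_dite_mul {n : ℕ} (ρ : QMatrix (Fin n)) (A : Finset (Fin n))
    (M : {i // i ∈ A} → Matrix (Fin 2) (Fin 2) ℂ) :
    (tensor (fun i => if h : i ∈ A then M ⟨i, h⟩ else 1) * ρ).trace =
      (tensor M * reduced ρ A).trace := by
  set e := (Equiv.piEquivPiSubtypeProd (fun i => i ∈ A) (fun _ : Fin n => Fin 2)).symm with he
  have h1 : ∀ (a b : {i // i ∈ A} → Fin 2) (c c' : {i // i ∉ A} → Fin 2),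
      tensor (fun i => if h : i ∈ A then M ⟨i, h⟩ else 1) (e (a, c)) (e (b, c')) =
        if c = c' then tensor M a b else 0 := by
    intro a b c c'
    unfold tensor
    rw [← Fintype.prod_subtype_mul_prod_subtype (fun i => i ∈ A)]
    have e1 : ∀ i : {i // i ∈ A}, (if h : (i : Fin n) ∈ A then M ⟨i, h⟩ else 1)
        (e (a, c) i) (e (b, c') i) = M i (a i) (b i) := by
      intro i
      simp [he, Equiv.piEquivPiSubtypeProd, i.2]
    have e2 : ∀ i : {i // i ∉ A}, (if h : (i : Fin n) ∈ A then M ⟨i, h⟩ else 1)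
        (e (a, c) i) (e (b, c') i) = if c i = c' i then 1 else 0 := by
      intro i
      simp [he, Equiv.piEquivPiSubtypeProd, i.2, Matrix.one_apply]
    simp only [e1, e2]
    by_cases hc : c = c'
    · simp only [hc, if_true, Finset.prod_const_one, mul_one]
      exact Finset.prod_congr (Finset.ext fun x => by simp) fun _ _ => rfl
    · obtain ⟨i, hi⟩ := Function.ne_iff.mp hc
      rw [if_neg hc, Finset.prod_eq_zero (Finset.mem_univ i) (if_neg hi), mul_zero]
  simp only [Matrix.trace, Matrix.diag, Matrix.mul_apply]
  rw [← e.sum_comp, Fintype.sum_prod_type]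
  refine Finset.sum_congr rfl fun a _ => ?_
  have h2 : ∀ c, ∑ q, tensor (fun i => if h : i ∈ A then M ⟨i, h⟩ else 1) (e (a, c)) q *
      ρ q (e (a, c)) = ∑ b, tensor M a b * ρ (e (b, c)) (e (a, c)) := by
    intro c
    rw [← e.sum_comp, Fintype.sum_prod_type]
    refine Finset.sum_congr rfl fun b _ => ?_
    simp only [h1, ite_mul, zero_mul, Finset.sum_ite_eq, Finset.mem_univ, if_true]
  simp only [h2, reduced, Finset.mul_sum]
  rw [Finset.sum_comm]

/-- The Pauli coefficient of a shadow factor on a subsystem. -/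
def stringCoeff {n : ℕ} {A : Finset (Fin n)} (Q : {i // i ∈ A} → Option (Fin 3))
    (s : Snapshot n) : ℝ :=
  ∏ i, pauliCoeff (Q i) (s i)

lemma prod_subtype_eq_prod_dite {n : ℕ} {A : Finset (Fin n)} (F : {i // i ∈ A} → ℝ) :
    ∏ i, F i = ∏ i, if h : i ∈ A then F ⟨i, h⟩ else 1 := by
  rw [← Fintype.prod_subtype_mul_prod_subtype (fun i => i ∈ A)]
  have e1 : ∀ i : {i // i ∈ A}, (if h : (i : Fin n) ∈ A then F ⟨i, h⟩ else 1) = F i := by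
    intro i
    simp [i.2]
  have e2 : ∀ i : {i // i ∉ A}, (if h : (i : Fin n) ∈ A then F ⟨i, h⟩ else 1) = 1 := by
    intro i
    simp [i.2]
  simp only [e1, e2, Finset.prod_const_one, mul_one]
  exact Finset.prod_congr (Finset.ext fun x => by simp) fun _ _ => rfl

/-- Unbiasedness on a subsystem: sites outside `A` carry the identity, which the partial trace
absorbs. -/
lemma sum_bornProb_mul_stringCoeff {n : ℕ} (ρ : State n) {A : Finset (Fin n)}
    (Q : {i // i ∈ A} → Option (Fin 3)) :
    ∑ s, bornProb ρ s * stringCoeff Q s = (pauliString Q * reduced ρ.1 A).trace.re := by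
  have h := sum_bornProb_mul_prod ρ
    (fun i o => pauliCoeff (if h : i ∈ A then Q ⟨i, h⟩ else none) o)
  simp only [sum_pauliCoeff_smul_proj] at h
  have e1 : (fun i => pauliBasis (if h : i ∈ A then Q ⟨i, h⟩ else none)) =
      fun i => if h : i ∈ A then pauliBasis (Q ⟨i, h⟩) else 1 := by
    funext i
    split_ifs <;> rfl
  rw [e1, trace_tensor_dite_mul ρ.1 A (fun i => pauliBasis (Q i))] at h
  rw [pauliString, ← h]
  refine Finset.sum_congr rfl fun s _ => ?_
  rw [stringCoeff, prod_subtype_eq_prod_dite]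
  congr 1
  refine Finset.prod_congr rfl fun i _ => ?_
  split_ifs <;> rfl

lemma sum_bornProb_mul_stringCoeff_sq_le {n : ℕ} (ρ : State n) {A : Finset (Fin n)}
    (Q : {i // i ∈ A} → Option (Fin 3)) :
    ∑ s, bornProb ρ s * stringCoeff Q s ^ 2 ≤ 3 ^ A.card := by
  have h := sum_bornProb_mul_prod ρ
    (fun i o => pauliCoeff (if h : i ∈ A then Q ⟨i, h⟩ else none) o ^ 2)
  simp only [sum_pauliCoeff_sq_smul_proj] at h
  have e1 : tensor (fun i : Fin n =>
      (pauliWeight (if h : i ∈ A then Q ⟨i, h⟩ else none) : ℂ) •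
        (1 : Matrix (Fin 2) (Fin 2) ℂ)) =
      ((∏ i, pauliWeight (if h : i ∈ A then Q ⟨i, h⟩ else none) : ℝ) : ℂ) •
        (1 : QMatrix (Fin n)) := by
    ext a b
    simp only [tensor, Matrix.smul_apply, Matrix.one_apply, smul_eq_mul, Finset.prod_mul_distrib,
      Finset.prod_ite_zero, Finset.prod_const_one, funext_iff, Finset.mem_univ, true_implies,
      Complex.ofReal_prod]
  rw [e1, Matrix.smul_mul, Matrix.one_mul, Matrix.trace_smul, ρ.2.2, smul_eq_mul, mul_one,
    Complex.ofReal_re] at h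
  have e2 : ∑ s, bornProb ρ s * stringCoeff Q s ^ 2 =
      ∑ s, bornProb ρ s *
        ∏ i, pauliCoeff (if h : i ∈ A then Q ⟨i, h⟩ else none) (s i) ^ 2 := by
    refine Finset.sum_congr rfl fun s _ => ?_
    rw [stringCoeff, prod_subtype_eq_prod_dite, ← Finset.prod_pow]
    congr 1
    refine Finset.prod_congr rfl fun i _ => ?_
    split_ifs <;> rfl
  rw [e2, h]
  calc ∏ i, pauliWeight (if h : i ∈ A then Q ⟨i, h⟩ else none)
      = ∏ i, if h : i ∈ A then pauliWeight (Q ⟨i, h⟩) else 1 := by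
        refine Finset.prod_congr rfl fun i _ => ?_
        split_ifs <;> rfl
    _ = ∏ i, pauliWeight (Q i) :=
        (prod_subtype_eq_prod_dite fun i => pauliWeight (Q i)).symm
    _ ≤ ∏ _i : {i // i ∈ A}, (3 : ℝ) := by
        refine Finset.prod_le_prod (fun i _ => ?_) fun i _ => ?_ <;>
        · unfold pauliWeight; split <;> norm_num
    _ = 3 ^ A.card := by simp

lemma abs_stringCoeff_le {n : ℕ} {A : Finset (Fin n)} (Q : {i // i ∈ A} → Option (Fin 3))
    (s : Snapshot n) : |stringCoeff Q s| ≤ 3 ^ A.card := by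
  rw [stringCoeff, Finset.abs_prod]
  calc ∏ i, |pauliCoeff (Q i) (s i)| ≤ ∏ _i : {i // i ∈ A}, (3 : ℝ) := by
        refine Finset.prod_le_prod (fun i _ => abs_nonneg _) fun i _ => ?_
        unfold pauliCoeff pm
        split
        · norm_num
        · split_ifs <;> norm_num
    _ = 3 ^ A.card := by simp

lemma trace_pauliString_mul_shadowState {n T : ℕ} (S : Shadow n T) {A : Finset (Fin n)}
    (Q : {i // i ∈ A} → Option (Fin 3)) :
    (pauliString Q * shadowState S A).trace =
      ((1 / (T : ℝ) * ∑ t, stringCoeff Q (S t) : ℝ) : ℂ) := by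
  simp only [shadowState, pauliString, Matrix.mul_smul, Matrix.mul_sum, Matrix.trace_smul,
    Matrix.trace_sum, tensor_mul, trace_tensor, trace_pauliBasis_mul_factor, smul_eq_mul,
    stringCoeff]
  push_cast
  rfl

/-- If all Pauli coefficients of the shadow estimate on `A` are accurate, then it is accurate in
trace norm. -/
lemma traceNormLE_shadowState_sub {n T : ℕ} (S : Shadow n T) (ρ : State n) (A : Finset (Fin n))
    {e : ℝ} (he : 0 ≤ e)
    (h : ∀ Q : {i // i ∈ A} → Option (Fin 3),
      |1 / (T : ℝ) * ∑ t, stringCoeff Q (S t) - ∑ s, bornProb ρ s * stringCoeff Q s| ≤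
        e / 2 ^ A.card) :
    TraceNormLE (shadowState S A - reduced ρ.1 A) e := by
  refine (traceNormLE_frobSq _).mono ?_
  rw [Real.sqrt_le_left he]
  have hP := sum_norm_trace_pauliString_sq (shadowState S A - reduced ρ.1 A)
  have hcard : (Fintype.card ({i // i ∈ A} → Fin 2) : ℝ) = 2 ^ Fintype.card {i // i ∈ A} := by
    simp
  rw [hcard, ← hP]
  have h1 : ∀ Q : {i // i ∈ A} → Option (Fin 3),
      ‖(pauliString Q * (shadowState S A - reduced ρ.1 A)).trace‖ ^ 2 ≤
        (e / 2 ^ A.card) ^ 2 := by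
    intro Q
    refine pow_le_pow_left₀ (norm_nonneg _) ?_ 2
    rw [Matrix.mul_sub, Matrix.trace_sub, trace_pauliString_mul_shadowState,
      trace_mul_eq_ofReal (M := pauliString Q)
        (isHermitian_tensor fun i => isHermitian_pauliBasis (Q i)) (reduced_posSemidef ρ.2.1 A).1,
      ← sum_bornProb_mul_stringCoeff, ← Complex.ofReal_sub, Complex.norm_real]
    exact h Q
  -- There are `4 ^ |A|` Pauli strings, each contributing `e² / 4 ^ |A|`.
  refine (Finset.sum_le_sum fun Q _ => h1 Q).trans (le_of_eq ?_)
  simp only [Finset.sum_const, Finset.card_univ, nsmul_eq_mul]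
  rw [Fintype.card_fun, Fintype.card_option, Fintype.card_fin, Fintype.card_coe, div_pow,
    ← pow_mul, mul_comm A.card 2, pow_mul]
  push_cast
  norm_num
  field_simp

end ShadowSVM
end

noncomputable section
namespace ShadowSVM
open MeasureTheory

/-! ### Concentration of classical shadows -/

/-- One-sided Bernstein-type tail bound for bounded variables of small second moment. -/
lemma measureReal_sum_ge_le {Z : Type} [Fintype Z] [MeasurableSpace Z]
    [MeasurableSingletonClass Z] (ν : Measure Z) [IsProbabilityMeasure ν] (X : Z → ℝ) {V η : ℝ}
    (hV : 0 < V) (hX : ∀ z, |X z| ≤ V) (hX2 : ∫ z, X z ^ 2 ∂ν ≤ V) (hη : 0 ≤ η) (hη2 : η ≤ 2)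
    (T : ℕ) :
    (Measure.pi fun _ : Fin T => ν).real {S | T * (∫ z, X z ∂ν + η) ≤ ∑ t, X (S t)} ≤
      Real.exp (-(T * η ^ 2 / (4 * V))) := by
  -- Minimizes the exponent `-lη + l²V`. The hypothesis `η ≤ 2` keeps `|l X| ≤ 1`, where `e^x ≤ 1 +
  -- x + x²` holds.
  set l : ℝ := η / (2 * V) with hl
  have hl0 : 0 ≤ l := by positivity
  have hlV : l * V = η / 2 := by rw [hl]; field_simp
  set m := ∫ z, X z ∂ν with hm
  have hmgf : ∫ z, Real.exp (l * X z) ∂ν ≤ Real.exp (l * m + l ^ 2 * V) := by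
    have h1 : ∀ z, Real.exp (l * X z) ≤ 1 + l * X z + l ^ 2 * X z ^ 2 := by
      intro z
      have h2 : |l * X z| ≤ 1 := by
        rw [abs_mul, abs_of_nonneg hl0]
        have := mul_le_mul_of_nonneg_left (hX z) hl0
        linarith
      have h3 := (abs_le.mp (Real.abs_exp_sub_one_sub_id_le h2)).2
      rw [mul_pow] at h3
      linarith
    calc ∫ z, Real.exp (l * X z) ∂ν ≤ ∫ z, (1 + l * X z + l ^ 2 * X z ^ 2) ∂ν :=
          integral_mono Integrable.of_finite Integrable.of_finite h1
      _ = 1 + l * m + l ^ 2 * ∫ z, X z ^ 2 ∂ν := by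
          rw [integral_add Integrable.of_finite Integrable.of_finite,
            integral_add Integrable.of_finite Integrable.of_finite, integral_const_mul,
            integral_const_mul]
          simp [hm]
      _ ≤ 1 + (l * m + l ^ 2 * V) := by
          have := mul_le_mul_of_nonneg_left hX2 (sq_nonneg l)
          linarith
      _ ≤ _ := by linarith [Real.add_one_le_exp (l * m + l ^ 2 * V)]
  set P := Measure.pi fun _ : Fin T => ν with hP
  have hprod : ∫ S, Real.exp (l * ∑ t, X (S t)) ∂P ≤ Real.exp (T * (l * m + l ^ 2 * V)) := by
    have e : ∀ S : Fin T → Z, Real.exp (l * ∑ t, X (S t)) = ∏ t, Real.exp (l * X (S t)) := by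
      intro S
      rw [Finset.mul_sum, Real.exp_sum]
    simp only [e]
    rw [hP, integral_fintype_prod_eq_prod (fun (_ : Fin T) z => Real.exp (l * X z)),
      Real.exp_nat_mul]
    simp only [Finset.prod_const, Finset.card_univ, Fintype.card_fin]
    exact pow_le_pow_left₀ (integral_nonneg fun _ => (Real.exp_pos _).le) hmgf T
  have hmarkov := mul_meas_ge_le_integral_of_nonneg (μ := P)
    (f := fun S => Real.exp (l * ∑ t, X (S t)))
    (Filter.Eventually.of_forall fun S => (Real.exp_pos _).le) Integrable.of_finite
    (Real.exp (l * (T * (m + η))))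
  have hle : P.real {S | T * (m + η) ≤ ∑ t, X (S t)} ≤
      P.real {S | Real.exp (l * (T * (m + η))) ≤ Real.exp (l * ∑ t, X (S t))} := by
    refine measureReal_mono fun S hS => ?_
    exact Real.exp_le_exp.mpr (mul_le_mul_of_nonneg_left hS hl0)
  refine hle.trans ?_
  have h4 := hmarkov.trans hprod
  rw [mul_comm, ← le_div_iff₀ (Real.exp_pos _), ← Real.exp_sub] at h4
  refine h4.trans (le_of_eq ?_)
  congr 1
  rw [hl]
  field_simp
  ring

lemma measureReal_abs_avg_sub_gt_le {Z : Type} [Fintype Z] [MeasurableSpace Z]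
    [MeasurableSingletonClass Z] (ν : Measure Z) [IsProbabilityMeasure ν] (X : Z → ℝ) {V η : ℝ}
    (hV : 0 < V) (hX : ∀ z, |X z| ≤ V) (hX2 : ∫ z, X z ^ 2 ∂ν ≤ V) (hη : 0 ≤ η) (hη2 : η ≤ 2)
    {T : ℕ} (hT : 1 ≤ T) :
    (Measure.pi fun _ : Fin T => ν).real
        {S | η < |1 / (T : ℝ) * ∑ t, X (S t) - ∫ z, X z ∂ν|} ≤
      2 * Real.exp (-(T * η ^ 2 / (4 * V))) := by
  have hT0 : (0 : ℝ) < T := by exact_mod_cast hT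
  have h1 := measureReal_sum_ge_le ν X hV hX hX2 hη hη2 T
  have h2 := measureReal_sum_ge_le ν (fun z => -X z) hV (by simpa using hX) (by simpa using hX2)
    hη hη2 T
  rw [integral_neg] at h2
  have hsub : {S : Fin T → Z | η < |1 / (T : ℝ) * ∑ t, X (S t) - ∫ z, X z ∂ν|} ⊆
      {S | T * (∫ z, X z ∂ν + η) ≤ ∑ t, X (S t)} ∪
        {S | T * (-∫ z, X z ∂ν + η) ≤ ∑ t, -X (S t)} := by
    intro S hS
    have e : ∑ t, X (S t) = T * (1 / (T : ℝ) * ∑ t, X (S t)) := by field_simp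
    simp only [Set.mem_ofPred_eq, Set.mem_union, Finset.sum_neg_distrib] at hS ⊢
    rcases lt_abs.mp hS with h | h
    · left
      rw [e]
      exact mul_le_mul_of_nonneg_left (by linarith) hT0.le
    · right
      rw [e, ← mul_neg]
      exact mul_le_mul_of_nonneg_left (by linarith) hT0.le
  calc _ ≤ _ := measureReal_mono hsub
    _ ≤ _ := measureReal_union_le _ _
    _ ≤ _ := by linarith

lemma integral_snapshotLaw {n : ℕ} (ρ : State n) (F : Snapshot n → ℝ) :
    ∫ s, F s ∂(snapshotLaw ρ) = ∑ s, bornProb ρ s * F s := by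
  rw [snapshotLaw, integral_finsetSum_measure fun s _ =>
    (integrable_dirac (by simp)).smul_measure ENNReal.ofReal_ne_top]
  refine Finset.sum_congr rfl fun s _ => ?_
  rw [integral_smul_measure, integral_dirac, ENNReal.toReal_ofReal (bornProb_nonneg ρ s),
    smul_eq_mul]

instance isProbabilityMeasure_snapshotLaw {n : ℕ} (ρ : State n) :
    IsProbabilityMeasure (snapshotLaw ρ) := by
  constructor
  simp only [snapshotLaw, Measure.coe_finsetSum, Finset.sum_apply, Measure.smul_apply,
    measure_univ, smul_eq_mul, mul_one]
  rw [← ENNReal.ofReal_sum_of_nonneg fun s _ => bornProb_nonneg ρ s, sum_bornProb,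
    ENNReal.ofReal_one]

instance isProbabilityMeasure_shadowLaw {n T : ℕ} (ρ : State n) :
    IsProbabilityMeasure (shadowLaw T ρ) := by
  unfold shadowLaw
  infer_instance

/-- Encode a subset by its increasing enumeration, padded with `none` to length `r`. -/
lemma card_subsystem_le (n r : ℕ) : Fintype.card (Subsystem n r) ≤ (n + 1) ^ r := by
  have hinj : Function.Injective (fun (A : Subsystem n r) (j : Fin r) =>
      (A.1.sort (· ≤ ·))[(j : ℕ)]?) := by
    intro A B h
    have hlen : ∀ A : Subsystem n r, (A.1.sort (· ≤ ·)).length ≤ r := fun A => by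
      rw [Finset.length_sort]; exact A.2
    have hl : A.1.sort (· ≤ ·) = B.1.sort (· ≤ ·) := by
      refine List.ext_getElem? fun j => ?_
      by_cases hj : j < r
      · exact congrFun h ⟨j, hj⟩
      · rw [List.getElem?_eq_none (by have := hlen A; omega),
          List.getElem?_eq_none (by have := hlen B; omega)]
    have := congrArg List.toFinset hl
    rw [Finset.sort_toFinset, Finset.sort_toFinset] at this
    exact Subtype.ext this
  have := Fintype.card_le_of_injective _ hinj
  simpa using this

lemma measureReal_iUnion_fintype_le' {Z ι : Type} [MeasurableSpace Z] [Fintype ι] (P : Measure Z)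
    [IsFiniteMeasure P] (s : ι → Set Z) {b : ℝ} (h : ∀ i, P.real (s i) ≤ b) :
    P.real (⋃ i, s i) ≤ Fintype.card ι * b := by
  refine (measureReal_iUnion_fintype_le s).trans ?_
  simpa using Finset.sum_le_sum fun i (_ : i ∈ Finset.univ) => h i

/-- All reduced density matrices on at most `r` qubits are estimated accurately in trace norm. -/
lemma measureReal_shadowState_inaccurate_le {n r T : ℕ} (hn : 1 ≤ n) (hT : 1 ≤ T) (ρ : State n)
    {e : ℝ} (he : 0 ≤ e) (he2 : e ≤ 2) :
    (shadowLaw T ρ).real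
      {S | ¬ ∀ A : Subsystem n r, TraceNormLE (shadowState S A.1 - reduced ρ.1 A.1) e} ≤
      (12 * n : ℝ) ^ r * (2 * Real.exp (-(T * e ^ 2 / (4 * 12 ^ r)))) := by
  have hn1 : (1 : ℝ) ≤ n := by exact_mod_cast hn
  set b : ℝ := 2 * Real.exp (-(T * e ^ 2 / (4 * 12 ^ r))) with hb
  have hb0 : 0 ≤ b := by positivity
  let bad : (A : Subsystem n r) → ({i // i ∈ A.1} → Option (Fin 3)) → Set (Shadow n T) :=
    fun A Q => {S | e / 2 ^ A.1.card < |1 / (T : ℝ) * ∑ t, stringCoeff Q (S t) -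
      ∫ s, stringCoeff Q s ∂(snapshotLaw ρ)|}
  have hsub : {S : Shadow n T | ¬ ∀ A : Subsystem n r,
      TraceNormLE (shadowState S A.1 - reduced ρ.1 A.1) e} ⊆ ⋃ A, ⋃ Q, bad A Q := by
    intro S hS
    simp only [Set.mem_ofPred_eq, not_forall] at hS
    obtain ⟨A, hA⟩ := hS
    by_contra hcon
    simp only [Set.mem_iUnion, not_exists] at hcon
    refine hA (traceNormLE_shadowState_sub S ρ A.1 he fun Q => ?_)
    have h1 := hcon A Q
    simp only [bad, Set.mem_ofPred_eq, not_lt, integral_snapshotLaw] at h1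
    exact h1
  have hbad : ∀ A Q, (shadowLaw T ρ).real (bad A Q) ≤ b := by
    intro A Q
    have h2 : (1 : ℝ) ≤ 2 ^ A.1.card := one_le_pow₀ (by norm_num)
    have h := measureReal_abs_avg_sub_gt_le (snapshotLaw ρ) (stringCoeff Q)
      (V := 3 ^ A.1.card) (η := e / 2 ^ A.1.card) (by positivity) (abs_stringCoeff_le Q)
      (by rw [integral_snapshotLaw]; exact sum_bornProb_mul_stringCoeff_sq_le ρ Q)
      (by positivity) ((div_le_self he h2).trans he2) hT
    refine h.trans (mul_le_mul_of_nonneg_left (Real.exp_le_exp.mpr (neg_le_neg ?_)) (by norm_num))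
    -- The base 12 is four, from the squared accuracy per Pauli coefficient, times three, from the
    -- second moment.
    have e1 : (T : ℝ) * (e / 2 ^ A.1.card) ^ 2 / (4 * 3 ^ A.1.card) =
        T * e ^ 2 / (4 * 12 ^ A.1.card) := by
      rw [show (12 : ℝ) = 2 ^ 2 * 3 by norm_num, mul_pow, ← pow_mul, mul_comm 2 A.1.card, pow_mul,
        div_pow]
      field_simp
    rw [e1]
    have h3 : (12 : ℝ) ^ A.1.card ≤ 12 ^ r := pow_le_pow_right₀ (by norm_num) A.2
    gcongr
  have hA : ∀ A, (shadowLaw T ρ).real (⋃ Q, bad A Q) ≤ 4 ^ r * b := by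
    intro A
    refine (measureReal_iUnion_fintype_le' _ _ (hbad A)).trans
      (mul_le_mul_of_nonneg_right ?_ hb0)
    rw [Fintype.card_fun, Fintype.card_option, Fintype.card_fin, Fintype.card_coe]
    push_cast
    exact pow_le_pow_right₀ (by norm_num) A.2
  refine (measureReal_mono hsub).trans ((measureReal_iUnion_fintype_le' _ _ hA).trans ?_)
  rw [← mul_assoc]
  refine mul_le_mul_of_nonneg_right ?_ hb0
  have h4 : (Fintype.card (Subsystem n r) : ℝ) ≤ (n + 1) ^ r := by
    exact_mod_cast card_subsystem_le n r
  calc (Fintype.card (Subsystem n r) : ℝ) * 4 ^ r ≤ (n + 1) ^ r * 4 ^ r := by gcongr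
    _ = ((n + 1) * 4 : ℝ) ^ r := by rw [mul_pow]
    _ ≤ (12 * n : ℝ) ^ r := by
        refine pow_le_pow_left₀ (by positivity) ?_ r
        linarith

end ShadowSVM
end

noncomputable section
namespace ShadowSVM
open MeasureTheory

/-! ### The truncated power series on classical shadows -/

/-- The truncated power series evaluated at the shadow estimates of the reduced density
matrices. -/
def shadowSeries {n r T : ℕ} (dp : ℕ) (O : Coefficients n r) (S : Shadow n T) : ℂ :=
  seriesAt dp O (fun A => shadowState S A.1)

lemma shadowSeries_zero {n r T : ℕ} (O : Coefficients n r) (S : Shadow n T) (ρ : State n) :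
    shadowSeries 0 O S = powerSeries 0 O ρ := by
  have e : ∀ A : Fin 0 → Subsystem n r, (fun j => shadowState S (A j).1) =
      fun j => reduced ρ.1 (A j).1 := fun A => funext fun j => j.elim0
  simp only [shadowSeries, seriesAt, powerSeries, zero_add, Finset.sum_range_one, e]

/-- The constant `512/3` makes the exponent at least `3L/2`, where `e^L = (12n)^r N / δ`. One `L`
cancels the union bound; since `N ≥ 16`, the remaining `L/2` is at least `log 4`. -/
lemma failure_exponent_le {n r dp N T : ℕ} (hn : 1 ≤ n) {C δ : ℝ} (hC : 3 / 4 ≤ C)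
    (hdp : 1 ≤ dp) (hδ : δ ∈ Set.Ioo (0 : ℝ) 1) (hN : (16 : ℝ) ≤ N)
    (hT : requiredShadowSize n r dp N C δ ≤ T) :
    (12 * n : ℝ) ^ r * (2 * Real.exp (-(T * (3 / (16 * dp * C)) ^ 2 / (4 * 12 ^ r)))) ≤
      δ / (2 * N) := by
  obtain ⟨hδ0, hδ1⟩ := hδ
  have hn0 : (0 : ℝ) < n := by exact_mod_cast hn
  have hn1 : (1 : ℝ) ≤ n := by exact_mod_cast hn
  have hdp0 : (0 : ℝ) < dp := by exact_mod_cast hdp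
  have hC0 : 0 < C := by linarith
  have hN0 : (0 : ℝ) < N := by linarith
  set L := (r : ℝ) * (Real.log n + Real.log 12) + Real.log (N / δ) with hL
  have hexp : Real.exp L = (12 * n : ℝ) ^ r * (N / δ) := by
    rw [hL, Real.exp_add, Real.exp_log (by positivity), add_comm (Real.log n),
      ← Real.log_mul (by norm_num) hn0.ne', Real.exp_nat_mul, Real.exp_log (by positivity)]
  have hL16 : 2 * Real.log 4 ≤ L := by
    have h1 : Real.log 16 ≤ Real.log (N / δ) := by
      refine Real.log_le_log (by norm_num) ?_
      rw [le_div_iff₀ hδ0]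
      nlinarith
    have h2 : Real.log 16 = 2 * Real.log 4 := by
      rw [show (16 : ℝ) = 4 ^ 2 by norm_num, Real.log_pow]; norm_num
    have h3 : 0 ≤ Real.log (n : ℝ) := Real.log_nonneg hn1
    have h4 : 0 ≤ Real.log (12 : ℝ) := Real.log_nonneg (by norm_num)
    have h5 : 0 ≤ (r : ℝ) * (Real.log n + Real.log 12) := by positivity
    linarith
  have hTL : L + Real.log 4 ≤ T * (3 / (16 * dp * C)) ^ 2 / (4 * 12 ^ r) := by
    have h1 := mul_le_mul_of_nonneg_right hT
      (by positivity : 0 ≤ (3 / (16 * dp * C)) ^ 2 / (4 * 12 ^ r))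
    have e1 : requiredShadowSize n r dp N C δ * ((3 / (16 * dp * C)) ^ 2 / (4 * 12 ^ r)) =
        3 / 2 * L := by
      rw [requiredShadowSize, ← hL]
      field_simp
      ring
    rw [e1, ← mul_div_assoc] at h1
    linarith
  have h1 : Real.exp (-(T * (3 / (16 * dp * C)) ^ 2 / (4 * 12 ^ r))) ≤
      ((12 * n : ℝ) ^ r * (N / δ))⁻¹ * 4⁻¹ := by
    rw [← hexp, ← Real.exp_neg, show (4 : ℝ)⁻¹ = Real.exp (-Real.log 4) by
      rw [Real.exp_neg, Real.exp_log (by norm_num)], ← Real.exp_add, Real.exp_le_exp]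
    linarith
  calc _ ≤ (12 * n : ℝ) ^ r * (2 * (((12 * n : ℝ) ^ r * (N / δ))⁻¹ * 4⁻¹)) := by gcongr
    _ = δ / (2 * N) := by
      field_simp
      norm_num

/-- The truncated power series is accurate on the classical shadow of every state, with high
probability. -/
lemma measureReal_shadowSeries_inaccurate_le {n r dp N T : ℕ} (hn : 1 ≤ n) (hT1 : 1 ≤ T)
    {C δ : ℝ} (hC : 3 / 4 ≤ C) (hδ : δ ∈ Set.Ioo (0 : ℝ) 1) (hN : (16 : ℝ) ≤ N)
    (hT : requiredShadowSize n r dp N C δ ≤ T) (O : Coefficients n r)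
    (hO : normalization dp O ≤ C) (ρ : State n) :
    (shadowLaw T ρ).real {S | 1 / 4 < ‖shadowSeries dp O S - powerSeries dp O ρ‖} ≤
      δ / (2 * N) := by
  have hδ0 := hδ.1
  -- For `dp = 0` the accuracy `3 / (16 dp C)` is meaningless and the size condition is void, but
  -- the series does not depend on the shadow at all.
  rcases Nat.eq_zero_or_pos dp with rfl | hdp
  · have e : {S : Shadow n T | 1 / 4 < ‖shadowSeries 0 O S - powerSeries 0 O ρ‖} = ∅ := by
      ext S
      simp only [shadowSeries_zero O S ρ, sub_self, norm_zero, Set.mem_ofPred_eq,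
        Set.mem_empty_iff_false, iff_false, not_lt]
      norm_num
    rw [e, measureReal_empty]
    positivity
  · have hC0 : 0 < C := by linarith
    have hdp1 : (1 : ℝ) ≤ dp := by exact_mod_cast hdp
    have he0 : 0 ≤ 3 / (16 * dp * C) := by positivity
    have he2 : 3 / (16 * dp * C) ≤ 2 := by
      rw [div_le_iff₀ (by positivity)]
      nlinarith
    refine le_trans (measureReal_mono fun S hS => ?_)
      ((measureReal_shadowState_inaccurate_le hn hT1 ρ he0 he2 (r := r)).trans
        (failure_exponent_le hn hC hdp hδ hN hT))
    intro hall
    have h1 := norm_seriesAt_sub_powerSeries_le (dp := dp) O ρ (fun A => shadowState S A.1) he0 hall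
    have h2 := mul_one_add_pow_sub_one_le hC hdp
    have h3 : 0 ≤ (1 + 3 / (16 * dp * C)) ^ dp - 1 := by
      have := one_le_pow₀ (n := dp) (by linarith : 1 ≤ 1 + 3 / (16 * dp * C))
      linarith
    have h4 := mul_le_mul_of_nonneg_right hO h3
    have h5 : 1 / 4 < ‖shadowSeries dp O S - powerSeries dp O ρ‖ := hS
    rw [shadowSeries] at h5
    linarith

/-! ### The law of the data -/

lemma measurable_bornProb {n : ℕ} (s : Snapshot n) : Measurable fun ρ : State n => bornProb ρ s := by
  have h : Measurable (fun (ρ : State n) (a b : Fin n → Fin 2) => ρ.1 a b) := comap_measurable _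
  have hentry : ∀ a b, Measurable fun ρ : State n => ρ.1 a b := fun a b =>
    (measurable_pi_apply b).comp ((measurable_pi_apply a).comp h)
  unfold bornProb
  refine Measurable.const_mul (Complex.measurable_re.comp ?_) _
  simp only [Matrix.trace, Matrix.diag, Matrix.mul_apply]
  exact Finset.measurable_sum _ fun a _ => Finset.measurable_sum _ fun b _ =>
    (hentry b a).const_mul _

lemma snapshotLaw_singleton {n : ℕ} (ρ : State n) (s : Snapshot n) :
    snapshotLaw ρ {s} = ENNReal.ofReal (bornProb ρ s) := by
  classical
  simp [snapshotLaw, Set.indicator_apply]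

/-- On the finite space of shadows the probability is a finite sum of products of Born
probabilities, which depend measurably on the matrix entries. -/
lemma measurable_shadowLaw {n T : ℕ} (E : Set (Shadow n T)) :
    Measurable fun ρ : State n => shadowLaw T ρ E := by
  classical
  have e : ∀ ρ : State n, shadowLaw T ρ E =
      ∑ S ∈ E.toFinset, ∏ t, ENNReal.ofReal (bornProb ρ (S t)) := by
    intro ρ
    conv_lhs => rw [← Set.coe_toFinset E, ← sum_measure_singleton]
    refine Finset.sum_congr rfl fun S _ => ?_
    rw [shadowLaw, Measure.pi_singleton]
    simp only [snapshotLaw_singleton]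
  simp only [e]
  exact Finset.measurable_sum _ fun S _ => Finset.measurable_prod _ fun t _ =>
    (measurable_bornProb _).ennreal_ofReal

open Classical in
lemma measurable_labelledShadowLaw {n T : ℕ} {A : Set (State n)} (hA : MeasurableSet A) :
    Measurable fun ρ : State n =>
      (shadowLaw T ρ).map (fun S => ((S, decide (ρ ∈ A)) : DataPoint n T)) := by
  refine Measure.measurable_of_measurable_coe _ fun E hE => ?_
  have e : (fun ρ : State n =>
      (shadowLaw T ρ).map (fun S => ((S, decide (ρ ∈ A)) : DataPoint n T)) E) =
      fun ρ => if ρ ∈ A then shadowLaw T ρ {S | (S, true) ∈ E}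
        else shadowLaw T ρ {S | (S, false) ∈ E} := by
    funext ρ
    rw [Measure.map_apply Measurable.of_discrete hE]
    split_ifs with h <;> simp [h, Set.preimage]
  rw [e]
  exact Measurable.ite hA (measurable_shadowLaw _) (measurable_shadowLaw _)

open Classical in
lemma dataLaw_apply {n T : ℕ} {A : Set (State n)} (hA : MeasurableSet A) (μ : Measure (State n))
    (E : Set (DataPoint n T)) :
    dataLaw T A μ E = ∫⁻ ρ, shadowLaw T ρ {S | (S, decide (ρ ∈ A)) ∈ E} ∂μ := by
  have hE : MeasurableSet E := E.toFinite.measurableSet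
  rw [dataLaw, Measure.bind_apply hE (measurable_labelledShadowLaw hA).aemeasurable]
  refine lintegral_congr fun ρ => ?_
  rw [Measure.map_apply Measurable.of_discrete hE]
  rfl

lemma isProbabilityMeasure_dataLaw {n T : ℕ} {A : Set (State n)} (hA : MeasurableSet A)
    (μ : Measure (State n)) [IsProbabilityMeasure μ] : IsProbabilityMeasure (dataLaw T A μ) := by
  constructor
  rw [dataLaw_apply hA]
  simp

end ShadowSVM
end

/-! ### Perfect training and good prediction with high probability. -/

noncomputable section
namespace ShadowSVM
open MeasureTheory
open scoped MatrixOrder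

/-- On a labelled data point drawn from the data law, twice the truncated power series has margin
one with high probability. -/
lemma dataLaw_margin_failure_le {n r dp N T : ℕ} (hn : 1 ≤ n) (hT1 : 1 ≤ T)
    {C δ : ℝ} (hC : 3 / 4 ≤ C) (hδ : δ ∈ Set.Ioo (0 : ℝ) 1) (hN : (16 : ℝ) ≤ N)
    (hT : requiredShadowSize n r dp N C δ ≤ T) {A B : Set (State n)} (hA : MeasurableSet A)
    (f : ReducedFamily n r → ℝ) (hfA : ∀ ρ ∈ A, 1 < f (reducedFamily r ρ))
    (hfB : ∀ ρ ∈ B, f (reducedFamily r ρ) < -1) (O : Coefficients n r)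
    (hfO : ∀ ρ : State n, ‖((f (reducedFamily r ρ) : ℝ) : ℂ) - powerSeries dp O ρ‖ ≤ 1 / 4)
    (hO : normalization dp O ≤ C) (μ : Measure (State n)) [IsProbabilityMeasure μ]
    (hμ : ∀ᵐ ρ ∂μ, ρ ∈ A ∪ B) :
    (dataLaw T A μ).real {x | ¬ 1 ≤ pm x.2 * (2 * (shadowSeries dp O x.1).re)} ≤
      δ / (2 * N) := by
  classical
  have hδ0 := hδ.1
  have hN0 : (0 : ℝ) < N := by linarith
  have hpos : 0 ≤ δ / (2 * N) := by positivity
  rw [measureReal_def]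
  refine ENNReal.toReal_le_of_le_ofReal hpos ?_
  rw [dataLaw_apply hA]
  have hae : ∀ᵐ ρ ∂μ, shadowLaw T ρ {S | (S, decide (ρ ∈ A)) ∈
      {x : DataPoint n T | ¬ 1 ≤ pm x.2 * (2 * (shadowSeries dp O x.1).re)}} ≤
      ENNReal.ofReal (δ / (2 * N)) := by
    filter_upwards [hμ] with ρ hρ
    rw [ENNReal.le_ofReal_iff_toReal_le (measure_ne_top _ _) hpos]
    refine le_trans (measureReal_mono fun S hS => ?_)
      (measureReal_shadowSeries_inaccurate_le hn hT1 hC hδ hN hT O hO ρ)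
    by_contra hgood
    have h1 : ‖shadowSeries dp O S - powerSeries dp O ρ‖ ≤ 1 / 4 := not_lt.mp hgood
    have h2 := abs_le.mp ((Complex.abs_re_le_norm _).trans h1)
    have h3 := abs_le.mp ((Complex.abs_re_le_norm _).trans (hfO ρ))
    rw [Complex.sub_re] at h2 h3
    rw [Complex.ofReal_re] at h3
    refine hS ?_
    -- Two errors of `1/4` separate the real part of the shadow series from `f`, so it exceeds `1/2`
    -- on `A` and is below `-1/2` on `B`.
    by_cases h : ρ ∈ A
    · have h4 := hfA ρ h
      simp only [h, decide_true, pm, if_true, one_mul]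
      linarith [h2.1, h3.2]
    · have h4 := hfB ρ (hρ.resolve_left h)
      simp only [h, decide_false, pm, Bool.false_eq_true, if_false]
      linarith [h2.2, h3.1]
  refine (lintegral_mono_ae hae).trans ?_
  simp

/-- Perfect training has high probability. -/
lemma one_sub_le_measureReal_perfectTraining {n r dp N T : ℕ} (hn : 1 ≤ n) {C δ : ℝ}
    (hN : (0 : ℝ) < N) (O : Coefficients n r) (hO : normalization dp O ≤ C)
    (D : Measure (DataPoint n T)) [IsProbabilityMeasure D]
    (hD : D.real {x | ¬ 1 ≤ pm x.2 * (2 * (shadowSeries dp O x.1).re)} ≤ δ / (2 * N)) :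
    1 - δ / 2 ≤ (Measure.pi (fun _ : Fin N => D)).real
      (PerfectTraining (marginSq n r dp C)) := by
  set P := Measure.pi (fun _ : Fin N => D) with hP
  have hΛ : 0 ≤ marginSq n r dp C := by unfold marginSq; positivity
  let bad : Fin N → Set (Fin N → DataPoint n T) := fun l =>
    (fun ω => ω l) ⁻¹' {x | ¬ 1 ≤ pm x.2 * (2 * (shadowSeries dp O x.1).re)}
  have hbad : ∀ l, P.real (bad l) ≤ δ / (2 * N) := by
    intro l
    refine le_trans (le_of_eq ?_) hD
    rw [measureReal_def, measureReal_def]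
    congr 1
    exact (measurePreserving_eval (fun _ : Fin N => D) l).measure_preimage
      (Set.toFinite _).measurableSet.nullMeasurableSet
  have hunion := measureReal_iUnion_fintype_le' P bad hbad
  have hsub : (⋃ l, bad l)ᶜ ⊆ PerfectTraining (marginSq n r dp C) := by
    intro ω hω
    refine mem_perfectTraining (shadowKernelMatrix_posSemidef n T) hΛ
      (fun S => 2 * (shadowSeries dp O S).re) (sq_dotProduct_two_mul_seriesAt_le hn O hO)
      fun l => ?_
    by_contra hl
    exact hω (Set.mem_iUnion.mpr ⟨l, hl⟩)
  refine le_trans ?_ (measureReal_mono hsub)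
  rw [probReal_compl_eq_one_sub (Set.toFinite _).measurableSet]
  have e : (Fintype.card (Fin N) : ℝ) * (δ / (2 * N)) = δ / 2 := by
    rw [Fintype.card_fin]; field_simp
  linarith

/-- The eigenvalues of a shadow factor are 2 and -1. -/
lemma frobSq_factor (s : Outcome) : frobSq (factor s) = 5 := by
  obtain ⟨w, b⟩ := s
  rw [frobSq_eq_trace (isHermitian_factor _)]
  simp only [Matrix.trace, Matrix.diag, Matrix.mul_apply, Fin.sum_univ_two, factor_apply]
  fin_cases w <;> cases b <;> simp [pauli, pm] <;> norm_num

/-- Cauchy-Schwarz bounds every single-qubit trace by 5. On the diagonal this is the squared radius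
of the feature vectors. -/
lemma shadowKernel_self_le {n T : ℕ} (hn : 1 ≤ n) (hT : 1 ≤ T) (S S' : Shadow n T) :
    shadowKernel 1 1 S S' ≤ Real.exp (Real.exp 5) := by
  have hn0 : (0 : ℝ) < n := by exact_mod_cast hn
  have hT0 : (0 : ℝ) < T := by exact_mod_cast hT
  have h1 : ∀ s s' : Outcome, ((factor s * factor s').trace).re ≤ 5 := by
    intro s s'
    have h := norm_trace_mul_sq_le (factor s) (factor s')
    rw [frobSq_factor, frobSq_factor] at h
    have h2 := abs_le_of_sq_le_sq (a := ‖(factor s * factor s').trace‖) (b := 5) (by linarith)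
      (by norm_num)
    exact (Complex.re_le_norm _).trans ((le_abs_self _).trans h2)
  refine Real.exp_le_exp.mpr ?_
  have h2 : ∀ t t' : Fin T, Real.exp (1 / (n : ℝ) * ∑ i : Fin n,
      ((factor (S t i) * factor (S' t' i)).trace).re) ≤ Real.exp 5 := by
    intro t t'
    refine Real.exp_le_exp.mpr ?_
    have h3 := Finset.sum_le_sum fun i (_ : i ∈ (Finset.univ : Finset (Fin n))) =>
      h1 (S t i) (S' t' i)
    simp only [Finset.sum_const, Finset.card_univ, Fintype.card_fin, nsmul_eq_mul] at h3
    rw [one_div_mul_eq_div, div_le_iff₀ hn0]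
    linarith
  have h4 := Finset.sum_le_sum fun t (_ : t ∈ (Finset.univ : Finset (Fin T))) =>
    Finset.sum_le_sum fun t' (_ : t' ∈ (Finset.univ : Finset (Fin T))) => h2 t t'
  simp only [Finset.sum_const, Finset.card_univ, Fintype.card_fin, nsmul_eq_mul] at h4
  rw [one_div_mul_eq_div, div_le_iff₀ (by positivity)]
  linarith

lemma sign_eq_pm_of_pos {b : Bool} {d : ℝ} (h : 0 < pm b * d) : Real.sign d = pm b := by
  cases b
  · simp only [pm, Bool.false_eq_true, if_false] at h ⊢
    exact Real.sign_of_neg (by linarith)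
  · simp only [pm, if_true, one_mul] at h ⊢
    exact Real.sign_of_pos h

/-- Perfect training without good prediction is unlikely. -/
lemma measureReal_perfectTraining_diff_goodPrediction_le {n T N : ℕ} (hn : 1 ≤ n) (hT : 1 ≤ T)
    {Λsq δ ε : ℝ} (hδ : δ ∈ Set.Ioo (0 : ℝ) 1) (hε : ε ∈ Set.Ioo (0 : ℝ) 1) (hΛ : 1 ≤ Λsq)
    (hN : 64 * Λsq * Real.exp (Real.exp 5) * Real.log (4 / δ) / ε ^ 2 ≤ N)
    (D : Measure (DataPoint n T)) [IsProbabilityMeasure D] :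
    (Measure.pi (fun _ : Fin N => D)).real (PerfectTraining Λsq \ GoodPrediction D Λsq ε) ≤
      δ / 4 := by
  classical
  have hδ0 := hδ.1
  obtain ⟨φ, hφ⟩ := exists_featureMap (shadowKernelMatrix_posSemidef n T)
  have hφ' : ∀ S S', inner ℝ (φ S) (φ S') = shadowKernel 1 1 S S' := hφ
  set R := Real.exp (Real.exp 5) with hR
  have hR0 : 0 < R := Real.exp_pos _
  have hR1 : 1 ≤ R := Real.one_le_exp (Real.exp_pos _).le
  have hpm : ∀ b, ‖pm b‖ = 1 := fun b => by cases b <;> simp [pm]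
  -- Absorbing the label into the feature vector turns every margin condition into a lower bound on
  -- one inner product.
  have hpac := pacBayes_margin (N := N) D (fun z => pm z.2 • φ z.1) (Rsq := R) (Λsq := Λsq)
    (ε := ε) (b := Real.sqrt (2 * R * Real.log (8 / ε))) (κ := δ / 4) hR0
    (fun z => by
      rw [norm_smul, hpm, one_mul, ← real_inner_self_eq_norm_sq, hφ']
      exact shadowKernel_self_le hn hT _ _)
    (Real.sqrt_nonneg _) (by positivity)
    (sampleSize_suffices hδ hε (one_le_mul_of_one_le_of_one_le hR1 hΛ) hR0 hN)
  refine le_trans (measureReal_mono ?_) hpac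
  rintro ω ⟨h1, h2⟩
  simp only [GoodPrediction, Set.mem_ofPred_eq, not_forall, not_le] at h2
  obtain ⟨α, hα, herr⟩ := h2
  have hin : ∀ x : DataPoint n T, inner ℝ (∑ l, α l • φ (ω l).1) (pm x.2 • φ x.1) =
      pm x.2 * decision ω α x.1 := by
    intro x
    rw [real_inner_smul_right, decision_eq_inner hφ']
  refine ⟨∑ l, α l • φ (ω l).1, (feasible_iff_norm hφ' _ _ _).mp hα.1, fun l => ?_, ?_⟩
  · rw [hin]
    exact one_le_margin_of_trainingError_eq_zero (h1 α hα) l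
  · refine herr.trans_le (measureReal_mono fun x hx => ?_)
    simp only [Set.mem_ofPred_eq, hin]
    by_contra hpos
    exact hx (sign_eq_pm_of_pos (not_le.mp hpos))

/-! ### Elementary bounds on the parameters. -/

lemma one_le_two_mul_pow {n : ℕ} (hn : 1 ≤ n) (r dp : ℕ) :
    (1 : ℝ) ≤ (2 * r * n : ℝ) ^ (r * dp) := by
  rcases Nat.eq_zero_or_pos r with hr | hr
  · simp [hr]
  · have hr1 : (1 : ℝ) ≤ r := by exact_mod_cast hr
    have hn1 : (1 : ℝ) ≤ n := by exact_mod_cast hn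
    refine one_le_pow₀ ?_
    nlinarith

lemma one_le_self_pow_self (dp : ℕ) : (1 : ℝ) ≤ (dp : ℝ) ^ dp := by
  rcases Nat.eq_zero_or_pos dp with h | h
  · simp [h]
  · exact one_le_pow₀ (by exact_mod_cast h)

/-- Supplies the slack needed in `failure_exponent_le`, and in particular a nonempty sample. -/
lemma sixteen_le_requiredTrainingSize {n r dp : ℕ} (hn : 1 ≤ n) {C δ ε : ℝ} (hC : 3 / 4 ≤ C)
    (hδ : δ ∈ Set.Ioo (0 : ℝ) 1) (hε : ε ∈ Set.Ioo (0 : ℝ) 1) :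
    16 ≤ requiredTrainingSize n r dp C δ ε := by
  obtain ⟨hδ0, hδ1⟩ := hδ
  obtain ⟨hε0, hε1⟩ := hε
  have h1 := one_le_two_mul_pow hn r dp
  have h2 := one_le_self_pow_self dp
  have h3 : 1 / 4 ≤ C ^ 2 := by nlinarith
  have h4 : 1 ≤ Real.exp (Real.exp 5) := Real.one_le_exp (Real.exp_pos _).le
  have h5 : 1 ≤ Real.log (4 / δ) := by
    have h6 : Real.log 4 ≤ Real.log (4 / δ) :=
      Real.log_le_log (by norm_num) (by rw [le_div_iff₀ hδ0]; nlinarith)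
    have h7 : Real.log 4 = 2 * Real.log 2 := by
      rw [show (4 : ℝ) = 2 ^ 2 by norm_num, Real.log_pow]; norm_num
    linarith [Real.log_two_gt_d9]
  have h8 : ε ^ 2 ≤ 1 := pow_le_one₀ hε0.le hε1.le
  unfold requiredTrainingSize
  rw [le_div_iff₀ (by positivity)]
  calc 16 * ε ^ 2 ≤ 256 * 1 * 1 * (1 / 4) * 1 * 1 := by linarith
    _ ≤ _ := by gcongr

lemma one_le_marginSq {n : ℕ} (hn : 1 ≤ n) (r dp : ℕ) {C : ℝ} (hC : 3 / 4 ≤ C) :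
    1 ≤ marginSq n r dp C := by
  have h1 := one_le_two_mul_pow hn r dp
  have h2 := one_le_self_pow_self dp
  have h3 : 1 / 4 ≤ C ^ 2 := by nlinarith
  unfold marginSq
  calc (1 : ℝ) = 4 * 1 * 1 * (1 / 4) := by norm_num
    _ ≤ _ := by gcongr

/-- For fixed parameters, polynomially many training data and logarithmically many measurements
suffice. -/
lemma exists_polynomial_sizes (r dp : ℕ) (C δ ε : ℝ) (hδ : δ ∈ Set.Ioo (0 : ℝ) 1)
    (hε : ε ∈ Set.Ioo (0 : ℝ) 1) :
    ∃ K : ℝ, ∀ n : ℕ, 1 ≤ n → ∃ N T : ℕ, 1 ≤ T ∧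
      requiredShadowSize n r dp N C δ ≤ T ∧ requiredTrainingSize n r dp C δ ε ≤ N ∧
      (N : ℝ) ≤ K * (n : ℝ) ^ (r * dp) ∧ (T : ℝ) ≤ K * (1 + Real.log n) := by
  obtain ⟨hδ0, hδ1⟩ := hδ
  obtain ⟨hε0, hε1⟩ := hε
  have hlog : 0 ≤ Real.log (4 / δ) := Real.log_nonneg (by rw [le_div_iff₀ hδ0]; linarith)
  set a : ℝ := 256 * (2 * r : ℝ) ^ (r * dp) * (dp : ℝ) ^ dp * C ^ 2 * Real.exp (Real.exp 5) *
    Real.log (4 / δ) / ε ^ 2 with ha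
  have ha0 : 0 ≤ a := by positivity
  set b : ℝ := 512 / 3 * (dp : ℝ) ^ 2 * C ^ 2 * 12 ^ r with hb
  have hb0 : 0 ≤ b := by positivity
  set c : ℝ := r * Real.log 12 + Real.log ((a + 2) / δ) with hc
  have hlog12 : 0 ≤ Real.log (12 : ℝ) := Real.log_nonneg (by norm_num)
  have hc0 : 0 ≤ c := by
    have : 0 ≤ Real.log ((a + 2) / δ) := Real.log_nonneg (by rw [le_div_iff₀ hδ0]; linarith)
    positivity
  refine ⟨(a + 2) + (b * (c + r + r * dp) + 2), fun n hn => ?_⟩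
  have hn1 : (1 : ℝ) ≤ n := by exact_mod_cast hn
  have hn0 : (0 : ℝ) < n := by linarith
  have hp1 : (1 : ℝ) ≤ (n : ℝ) ^ (r * dp) := one_le_pow₀ hn1
  have hlogn : 0 ≤ Real.log (n : ℝ) := Real.log_nonneg hn1
  have hreq : requiredTrainingSize n r dp C δ ε = a * (n : ℝ) ^ (r * dp) := by
    rw [requiredTrainingSize, ha, mul_pow]
    ring
  -- The extra one keeps `N` positive, hence `log (N / δ)` nonnegative, even when `a` vanishes.
  set N : ℕ := ⌈a * (n : ℝ) ^ (r * dp)⌉₊ + 1 with hN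
  have hNle : (N : ℝ) ≤ (a + 2) * (n : ℝ) ^ (r * dp) := by
    have := (Nat.ceil_lt_add_one (by positivity : 0 ≤ a * (n : ℝ) ^ (r * dp))).le
    rw [hN]
    push_cast
    linarith
  have hN1 : (1 : ℝ) ≤ N := by exact_mod_cast (by omega : 1 ≤ N)
  have hlogN : Real.log (N / δ) ≤ Real.log ((a + 2) / δ) + r * dp * Real.log n := by
    have h1 : (N : ℝ) / δ ≤ (a + 2) / δ * (n : ℝ) ^ (r * dp) := by
      rw [div_mul_eq_mul_div]
      gcongr
    refine (Real.log_le_log (by positivity) h1).trans (le_of_eq ?_)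
    rw [Real.log_mul (by positivity) (by positivity), Real.log_pow]
    push_cast
    ring
  have hlogN0 : 0 ≤ Real.log (N / δ) := Real.log_nonneg (by rw [le_div_iff₀ hδ0]; linarith)
  have hS0 : 0 ≤ requiredShadowSize n r dp N C δ := by
    unfold requiredShadowSize
    positivity
  have hSle : requiredShadowSize n r dp N C δ ≤ b * (c + r + r * dp) * (1 + Real.log n) := by
    rw [requiredShadowSize, ← hb, mul_assoc b]
    refine mul_le_mul_of_nonneg_left ?_ hb0
    have h1 : 0 ≤ c * Real.log n := by positivity
    have h2 : (0 : ℝ) ≤ r := by positivity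
    have h3 : (0 : ℝ) ≤ r * dp := by positivity
    have e : (c + r + r * dp) * (1 + Real.log n) =
        c + r + r * dp + c * Real.log n + r * Real.log n + r * dp * Real.log n := by ring
    rw [e]
    have e2 : (r : ℝ) * (Real.log n + Real.log 12) = r * Real.log n + r * Real.log 12 := by ring
    rw [e2]
    linarith
  refine ⟨N, ⌈requiredShadowSize n r dp N C δ⌉₊ + 1, by omega, ?_, ?_, ?_, ?_⟩
  · push_cast
    linarith [Nat.le_ceil (requiredShadowSize n r dp N C δ)]
  · rw [hreq, hN]
    push_cast
    linarith [Nat.le_ceil (a * (n : ℝ) ^ (r * dp))]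
  · refine hNle.trans (mul_le_mul_of_nonneg_right ?_ (by positivity))
    have : 0 ≤ b * (c + r + r * dp) := by positivity
    linarith
  · have h1 := (Nat.ceil_lt_add_one hS0).le
    push_cast
    have e : (a + 2 + (b * (c + r + r * dp) + 2)) * (1 + Real.log n) =
      a * (1 + Real.log n) + 4 * (1 + Real.log n) +
        b * (c + r + r * dp) * (1 + Real.log n) := by ring
    rw [e]
    have : 0 ≤ a * (1 + Real.log n) := by positivity
    linarith

/-- A phase separated by a function close to a truncated power series forces a lower bound on its
normalization. -/
lemma three_quarters_le_normalization {n r dp : ℕ} {f : ReducedFamily n r → ℝ}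
    {O : Coefficients n r} {ρ : State n} (hf : 1 < |f (reducedFamily r ρ)|)
    (hfO : ‖((f (reducedFamily r ρ) : ℝ) : ℂ) - powerSeries dp O ρ‖ ≤ 1 / 4) :
    3 / 4 ≤ normalization dp O := by
  have h1 := norm_powerSeries_le dp O ρ
  have h2 := norm_sub_norm_le ((f (reducedFamily r ρ) : ℝ) : ℂ) (powerSeries dp O ρ)
  rw [Complex.norm_real, Real.norm_eq_abs] at h2
  linarith

end ShadowSVM
end

/-! ### Assembly of the guarantee. -/

theorem mainTheorem2 (r dp : ℕ) (C δ ε : ℝ) (hδ : δ ∈ Set.Ioo (0 : ℝ) 1)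
    (hε : ε ∈ Set.Ioo (0 : ℝ) 1) :
    -- the guarantee, for every number of qubits and every pair of phases
    (∀ (n : ℕ) (_ : 1 ≤ n) (A B : Set (ShadowSVM.State n))
        (_ : MeasurableSet A) (_ : MeasurableSet B)
        -- a function of the reduced density matrices on at most `r` qubits separates the phases
        (f : ShadowSVM.ReducedFamily n r → ℝ)
        (_ : ∀ ρ ∈ A, 1 < f (ShadowSVM.reducedFamily r ρ))
        (_ : ∀ ρ ∈ B, f (ShadowSVM.reducedFamily r ρ) < -1)
        -- it is approximated by a truncated power series with normalization at most `C`
        (O : ShadowSVM.Coefficients n r)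
        (_ : ∀ ρ : ShadowSVM.State n,
          ‖((f (ShadowSVM.reducedFamily r ρ) : ℝ) : ℂ) - ShadowSVM.powerSeries dp O ρ‖ ≤ 1 / 4)
        (_ : ShadowSVM.normalization dp O ≤ C)
        -- states are drawn from a distribution on the two phases
        (μ : MeasureTheory.Measure (ShadowSVM.State n))
        (_ : MeasureTheory.IsProbabilityMeasure μ)
        (_ : ∀ᵐ ρ ∂μ, ρ ∈ A ∪ B)
        (N T : ℕ) (_ : 1 ≤ T)
        (_ : ShadowSVM.requiredShadowSize n r dp N C δ ≤ T)
        (_ : ShadowSVM.requiredTrainingSize n r dp C δ ε ≤ N),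
      let D : MeasureTheory.Measure (ShadowSVM.DataPoint n T) := ShadowSVM.dataLaw T A μ
      let P : MeasureTheory.Measure (Fin N → ShadowSVM.DataPoint n T) :=
        MeasureTheory.Measure.pi (fun _ => D)
      let Λsq : ℝ := ShadowSVM.marginSq n r dp C
      (∀ ω : Fin N → ShadowSVM.DataPoint n T, ∃ α, ShadowSVM.IsSolution Λsq ω α) ∧
      1 - δ / 2 ≤ P.real (ShadowSVM.PerfectTraining Λsq) ∧
      1 - δ / 2 ≤ (ProbabilityTheory.cond P (ShadowSVM.PerfectTraining Λsq)).real
        (ShadowSVM.GoodPrediction D Λsq ε) ∧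
      1 - δ ≤ P.real (ShadowSVM.PerfectTraining Λsq ∩ ShadowSVM.GoodPrediction D Λsq ε)) ∧
    -- for fixed `r`, `dp`, `C`, `δ`, `ε`, polynomially many training data and
    -- logarithmically many measurements per state suffice
    (∃ K : ℝ, ∀ n : ℕ, 1 ≤ n → ∃ N T : ℕ, 1 ≤ T ∧
      ShadowSVM.requiredShadowSize n r dp N C δ ≤ T ∧
      ShadowSVM.requiredTrainingSize n r dp C δ ε ≤ N ∧
      (N : ℝ) ≤ K * (n : ℝ) ^ (r * dp) ∧
      (T : ℝ) ≤ K * (1 + Real.log n)) := by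
  refine ⟨?_, ShadowSVM.exists_polynomial_sizes r dp C δ ε hδ hε⟩
  intro n hn A B hA hB f hfA hfB O hfO hO μ hμ hAB N T hT1 hT hN D P Λsq
  have hδ0 := hδ.1
  have hδ1 := hδ.2
  -- A probability measure has a point in its full-measure event; the separation there forces `C ≥
  -- 3/4`.
  obtain ⟨ρ, hρ⟩ := hAB.exists
  have hf1 : 1 < |f (ShadowSVM.reducedFamily r ρ)| := by
    rcases hρ with h | h
    · exact lt_abs.mpr (Or.inl (hfA ρ h))
    · exact lt_abs.mpr (Or.inr (by linarith [hfB ρ h]))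
  have hC : 3 / 4 ≤ C := (ShadowSVM.three_quarters_le_normalization hf1 (hfO ρ)).trans hO
  have hN16 : (16 : ℝ) ≤ N := (ShadowSVM.sixteen_le_requiredTrainingSize hn hC hδ hε).trans hN
  have hΛ : 1 ≤ Λsq := ShadowSVM.one_le_marginSq hn r dp hC
  have hD : MeasureTheory.IsProbabilityMeasure D := ShadowSVM.isProbabilityMeasure_dataLaw hA μ
  have hmargin := ShadowSVM.dataLaw_margin_failure_le hn hT1 hC hδ hN16 hT hA f hfA hfB O hfO hO
    μ hAB
  have hperfect : 1 - δ / 2 ≤ P.real (ShadowSVM.PerfectTraining Λsq) :=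
    ShadowSVM.one_sub_le_measureReal_perfectTraining hn (by linarith) O hO D hmargin
  have hN' : 64 * Λsq * Real.exp (Real.exp 5) * Real.log (4 / δ) / ε ^ 2 ≤ N := by
    refine le_trans (le_of_eq ?_) hN
    simp only [Λsq, ShadowSVM.marginSq, ShadowSVM.requiredTrainingSize]
    ring
  have hdiff : P.real (ShadowSVM.PerfectTraining Λsq \ ShadowSVM.GoodPrediction D Λsq ε) ≤ δ / 4 :=
    ShadowSVM.measureReal_perfectTraining_diff_goodPrediction_le hn hT1 hδ hε hΛ hN' D
  have hsplit := MeasureTheory.measureReal_inter_add_sdiff (μ := P)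
    (s := ShadowSVM.PerfectTraining Λsq) (t := ShadowSVM.GoodPrediction D Λsq ε)
    (Set.toFinite _).measurableSet
  refine ⟨fun ω => ?_, hperfect, ?_, by linarith⟩
  · obtain ⟨φ, hφ⟩ := ShadowSVM.exists_featureMap (ShadowSVM.shadowKernelMatrix_posSemidef n T)
    exact ShadowSVM.exists_isSolution hφ (by linarith) ω
  -- The conditional failure probability is at most `(δ/4) / (1 - δ/2)`, which is at most `δ/2`
  -- because `δ < 1`.
  · have hpos : 0 < P.real (ShadowSVM.PerfectTraining Λsq) := by linarith
    rw [MeasureTheory.measureReal_def,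
      ProbabilityTheory.cond_apply (Set.toFinite _).measurableSet, ENNReal.toReal_mul,
      ENNReal.toReal_inv, ← MeasureTheory.measureReal_def, ← MeasureTheory.measureReal_def,
      inv_mul_eq_div, le_div_iff₀ hpos]
    nlinarith
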